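/- Let $n\ge 0$, let $I^n=[0,1]^n$ with facets $F_j=\{p_j=0\}$ and $F_{n+j}=\{p_j=1\}$ $(1\le j\le n)$, and let $\mathbb Z_2=\mathbb Z/2$. A *small cover* over $I^n$ is a smooth closed $n$-manifold $X$ with a smooth, locally standard action of $\mathbb Z_2^n$ (every point has an invariant open neighbourhood that is equivariantly diffeomorphic, up to an automorphism of $\mathbb Z_2^n$, to an invariant open subset of $\mathbb R^n$ with the action by sign changes of coordinates), together with a projection $\pi\colon X\to I^n$ that identifies the orbit space with $I^n$ by a homeomorphism of manifolds with corners (so the isotropy group of $x$ has rank equal to the codimension of the minimal face containing $\pi(x)$). Two small covers $X,Y$ over $I^n$ are *Davis–Januszkiewicz (D-J) equivalent* if there are an automorphism $\varphi$ of $\mathbb Z_2^n$ and a homeomorphism $f\colon X\to Y$ with $f(t\cdot x)=\varphi(t)\cdot f(x)$ for all $t,x$ and $\pi_Y\circ f=\pi_X$. A *digraph* on $n$ labeled nodes has at most one edge from $i$ to $j$ for each ordered pair $(i,j)$ (including $i=j$); it is *acyclic* if it has no directed cycle of any length $\ge 1$. Let $M(n)$ be the set of $n\times n$ matrices over $\mathbb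 Z_2$ all of whose principal minors are $1$. Theorem. The number of D-J equivalence classes of small covers over $I^n$ is equal to the number of acyclic digraphs on $n$ labeled nodes. More precisely: (a) Every small cover $X$ over $I^n$ has a characteristic matrix $\Lambda=(A\mid B)=(\lambda(F_1)\cdots\lambda(F_{2n}))$ with $A,B$ of size $n\times n$, where $\lambda(F)\in\mathbb Z_2^n$ generates the isotropy group of each point of $X$ lying over the relative interior of $F$; the matrix $A$ is invertible, and $X\mapsto A^{-1}B$ induces a bijection from the set of D-J equivalence classes of small covers over $I^n$ onto $M(n)$. (b) The map $G\mapsto E_n+A(G)$, where $E_n$ is the identity matrix and $A(G)$ is the adjacency matrix of $G$ with entries in $\mathbb Z_2$, is a bijection from the set of acyclic digraphs on $n$ labeled nodes onto $M(n)$. -/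

import Mathlib

open scoped Manifold ContDiff

universe u

/-- The group `ℤ₂ⁿ`, written additively. -/
abbrev Z2 (n : ℕ) : Type := Fin n → ZMod 2

/-- The cube `Iⁿ`, with the product topology. -/
abbrev Cube (n : ℕ) : Type := Fin n → unitInterval

namespace Cube

/-- The `2n` facets of the cube: `inl j` is `F_j = {p_j = 0}` and `inr j` is the opposite facet
`F_{n+j} = {p_j = 1}`. -/
def facet {n : ℕ} : Fin n ⊕ Fin n → Set (Cube n)
  | Sum.inl j => {p | p j = 0}
  | Sum.inr j => {p | p j = 1}

/-- The relative interior of a facet: the points that lie on this facet and on no other one. -/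
def facetInterior {n : ℕ} (F : Fin n ⊕ Fin n) : Set (Cube n) :=
  {p | p ∈ facet F ∧ ∀ F' : Fin n ⊕ Fin n, F' ≠ F → p ∉ facet F'}

/-- The codimension of the minimal face containing `p`: the number of facets through `p`
(the cube is a simple polytope). -/
noncomputable def codim {n : ℕ} (p : Cube n) : ℕ :=
  Set.ncard {F : Fin n ⊕ Fin n | p ∈ facet F}

end Cube

/-- The standard action of `ℤ₂ⁿ` on `ℝⁿ` by sign changes of the coordinates. -/
noncomputable def stdAct {n : ℕ} (t : Z2 n) (x : EuclideanSpace ℝ (Fin n)) :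
    EuclideanSpace ℝ (Fin n) :=
  WithLp.toLp 2 fun i => (-1 : ℝ) ^ (t i).val * x i

/-- An action of `ℤ₂ⁿ` on a smooth `n`-manifold `M` is locally standard if every point has an
invariant open neighbourhood (`f.source`) which is weakly equivariantly diffeomorphic (by `f`, along
an automorphism `θ` of `ℤ₂ⁿ`) to an invariant open subset of `ℝⁿ` with the standard action. -/
def IsLocallyStandard (n : ℕ) (M : Type u) [TopologicalSpace M]
    [ChartedSpace (EuclideanSpace ℝ (Fin n)) M] [AddAction (Z2 n) M] : Prop :=
  ∀ x : M, ∃ (θ : Z2 n ≃+ Z2 n) (f : OpenPartialHomeomorph M (EuclideanSpace ℝ (Fin n))),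
    f ∈ IsManifold.maximalAtlas (𝓡 n) ∞ M ∧ x ∈ f.source ∧
      ∀ (t : Z2 n), ∀ y ∈ f.source, t +ᵥ y ∈ f.source ∧ f (t +ᵥ y) = stdAct (θ t) (f y)

/-- A small cover over the cube `Iⁿ`: a smooth closed `n`-manifold with a smooth locally standard
action of `ℤ₂ⁿ`, together with an identification of its orbit space with `Iⁿ` as manifolds with
corners. -/
structure SmallCover (n : ℕ) : Type (u + 1) where
  /-- the underlying manifold -/
  carrier : Type u
  [topology : TopologicalSpace carrier]
  [charts : ChartedSpace (EuclideanSpace ℝ (Fin n)) carrier]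
  [smooth : IsManifold (𝓡 n) ∞ carrier]
  [hausdorff : T2Space carrier]
  [compact : CompactSpace carrier]
  [action : AddAction (Z2 n) carrier]
  smooth_action : ∀ t : Z2 n, ContMDiff (𝓡 n) (𝓡 n) ∞ (fun x : carrier => t +ᵥ x)
  locallyStandard : IsLocallyStandard n carrier
  /-- the projection to the orbit space, which is identified with the cube -/
  proj : carrier → Cube n
  isQuotientMap_proj : Topology.IsQuotientMap proj
  proj_eq_iff : ∀ x y : carrier, proj x = proj y ↔ ∃ t : Z2 n, t +ᵥ x = y
  /-- The identification of the orbit space with the cube respects the corner structures. The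
  codimension of an orbit in the orbit space is the number of vanishing coordinates in a standard
  chart, that is the rank `k` of the isotropy group, which has order `2 ^ k`. -/
  card_stabilizer : ∀ x : carrier,
    Nat.card (AddAction.stabilizer (Z2 n) x) = 2 ^ (proj x).codim

namespace SmallCover

attribute [instance] topology charts smooth hausdorff compact action

/-- Davis–Januszkiewicz equivalence: there is a weakly `ℤ₂ⁿ`-equivariant homeomorphism covering the
identity of the cube. -/
def DJEquiv {n : ℕ} (X Y : SmallCover.{u} n) : Prop :=
  ∃ (φ : Z2 n ≃+ Z2 n) (f : X.carrier ≃ₜ Y.carrier),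
    (∀ (t : Z2 n) (x : X.carrier), f (t +ᵥ x) = φ t +ᵥ f x) ∧
      ∀ x : X.carrier, Y.proj (f x) = X.proj x

/-- Davis–Januszkiewicz equivalence is an equivalence relation. -/
def djSetoid (n : ℕ) : Setoid (SmallCover.{u} n) where
  r := DJEquiv
  iseqv :=
    { refl := fun X => ⟨AddEquiv.refl _, Homeomorph.refl _, fun _ _ => rfl, fun _ => rfl⟩
      symm := by
        rintro X Y ⟨φ, f, h, hp⟩
        refine ⟨φ.symm, f.symm, fun t y => ?_, fun y => ?_⟩
        · rw [Homeomorph.symm_apply_eq, h]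
          simp
        · rw [← hp]
          simp
      trans := by
        rintro X Y Z ⟨φ, f, h, hp⟩ ⟨ψ, g, k, kp⟩
        refine ⟨φ.trans ψ, f.trans g, fun t x => ?_, fun x => ?_⟩
        · simp [h, k]
        · simp [hp, kp] }

/-- The Davis–Januszkiewicz equivalence classes of small covers over the `n`-cube. -/
def DJClass (n : ℕ) : Type (u + 1) := Quotient (djSetoid.{u} n)

/-- The D-J class of a small cover. -/
def djClass {n : ℕ} (X : SmallCover.{u} n) : DJClass.{u} n := Quotient.mk (djSetoid n) X

/-- `Λ = (λ(F_1) ⋯ λ(F_{2n}))` is the matrix of the characteristic function of `X`: the isotropy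
group of the points over the relative interior of each facet `F` is generated by `λ(F)`. -/
def IsCharMatrix {n : ℕ} (X : SmallCover.{u} n) (Λ : Matrix (Fin n) (Fin n ⊕ Fin n) (ZMod 2)) :
    Prop :=
  ∀ (F : Fin n ⊕ Fin n) (x : X.carrier), X.proj x ∈ Cube.facetInterior F →
    AddAction.stabilizer (Z2 n) x = AddSubgroup.zmultiples (fun i => Λ i F)

end SmallCover

/-- `M(n)`: the `n × n` matrices over `ℤ₂` all of whose principal minors are `1`. -/
def principalMinorsOne (n : ℕ) : Set (Matrix (Fin n) (Fin n) (ZMod 2)) :=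
  {B | ∀ S : Finset (Fin n), (B.submatrix (fun i : S => (i : Fin n)) (fun i : S => (i : Fin n))).det = 1}

namespace Digraph

/-- A digraph (loops allowed) is acyclic if it has no directed cycle of any length `≥ 1`. -/
def IsAcyclicDigraph {V : Type*} (G : Digraph V) : Prop :=
  ∀ v : V, ¬ Relation.TransGen G.Adj v v

open scoped Classical in
/-- The vertex adjacency matrix of a digraph, with entries in `ℤ₂`. -/
noncomputable def adjMatrixZ2 {V : Type*} (G : Digraph V) : Matrix V V (ZMod 2) :=
  Matrix.of fun i j => if G.Adj i j then 1 else 0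

end Digraph

/-! For (b): in the Leibniz expansion of det(E + A(G)) a nonzero term other than the identity would
trace a directed cycle, so an acyclic digraph has all principal minors 1. Conversely, a digraph with
a cycle has a nonempty vertex set in which every vertex has exactly one out-neighbour, and the
all-ones vector is in the kernel of the corresponding principal submatrix.

For (a): isotropy is constant over the interior of a facet, which defines Λ. A standard chart at a
fixed point shows that the columns of the facets through a vertex form a basis
(`IsCharMatrix.isUnit_vertexMatrix`). After normalising Λ to (E | A⁻¹B), the determinants at the
vertices are the principal minors of A⁻¹B, which therefore lies in M(n). A D-J equivalence
multiplies Λ on the left by an invertible matrix, so A⁻¹B is an invariant. It is complete because π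
has a continuous section (`exists_section`): X is then ℤ₂ⁿ × Iⁿ glued along isotropy groups, and
these are read off from Λ.

Every B in M(n) is realised by a real Bott manifold: ℝⁿ modulo the maps that translate by 2k after
the sign changes (E + B)k mod 2. Nonsingularity at the vertices makes the quotient map injective on
a box around each vertex of the unit cube (`injOn_param`), and these boxes give equivariant charts.
-/

namespace Digraph

/-! ### Acyclic digraphs and principal minors -/

variable {V : Type*}

/-- Iterating `σ` from a moved vertex walks backwards along edges and returns after `orderOf σ`
steps, which is a directed cycle. -/
theorem isAcyclicDigraph_perm_fixed {G : Digraph V} (hG : G.IsAcyclicDigraph) [Finite V]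
    (σ : Equiv.Perm V) (hσ : ∀ v, σ v ≠ v → G.Adj (σ v) v) : σ = 1 := by
  by_contra hne
  obtain ⟨v, hv⟩ : ∃ v, σ v ≠ v := by
    by_contra! h
    exact hne (Equiv.ext h)
  have hstep : ∀ k : ℕ, σ ((σ ^ k) v) ≠ (σ ^ k) v := by
    intro k h
    rw [← Equiv.Perm.mul_apply, (Commute.self_pow σ k).eq, Equiv.Perm.mul_apply] at h
    exact hv ((σ ^ k).injective h)
  have key : ∀ k : ℕ, Relation.TransGen G.Adj ((σ ^ (k + 1)) v) v := by
    intro k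
    induction k with
    | zero => simpa using Relation.TransGen.single (hσ v hv)
    | succ k ih =>
      refine Relation.TransGen.head ?_ ih
      rw [pow_succ' σ (k + 1), Equiv.Perm.mul_apply]
      exact hσ _ (hstep _)
  have h := key (orderOf σ - 1)
  rw [Nat.sub_add_cancel (orderOf_pos σ), pow_orderOf_eq_one] at h
  exact hG v h

theorem IsAcyclicDigraph.not_adj_self {G : Digraph V} (hG : G.IsAcyclicDigraph) (v : V) :
    ¬ G.Adj v v := fun h => hG v (Relation.TransGen.single h)

/-- Only the identity contributes to the Leibniz sum: any other permutation moves some vertex along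
a non-edge, and that factor vanishes. -/
theorem det_one_add_adjMatrixZ2 {G : Digraph V} (hG : G.IsAcyclicDigraph) [Fintype V]
    [DecidableEq V] : (1 + G.adjMatrixZ2).det = 1 := by
  rw [Matrix.det_apply, Finset.sum_eq_single 1]
  · rw [Equiv.Perm.sign_one, one_smul]
    refine Finset.prod_eq_one fun v _ => ?_
    simp [adjMatrixZ2, hG.not_adj_self]
  · intro σ _ hσ
    have : ∃ v, σ v ≠ v ∧ ¬ G.Adj (σ v) v := by
      by_contra! h
      exact hσ (isAcyclicDigraph_perm_fixed hG σ h)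
    obtain ⟨v, hv, hadj⟩ := this
    rw [Finset.prod_eq_zero (Finset.mem_univ v), smul_zero]
    simp [adjMatrixZ2, hv, hadj]
  · simp

theorem IsAcyclicDigraph.comap {W : Type*} {G : Digraph V} (hG : G.IsAcyclicDigraph)
    (f : W → V) : IsAcyclicDigraph (⟨fun a b => G.Adj (f a) (f b)⟩ : Digraph W) := by
  intro w hw
  exact hG (f w) (hw.lift f fun _ _ h => h)

theorem one_add_adjMatrixZ2_mem {n : ℕ} {G : Digraph (Fin n)} (hG : G.IsAcyclicDigraph) :
    1 + G.adjMatrixZ2 ∈ principalMinorsOne n := by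
  intro S
  rw [← det_one_add_adjMatrixZ2 (hG.comap (fun i : S => (i : Fin n)))]
  congr 1
  ext i j
  simp only [adjMatrixZ2, Matrix.submatrix_apply, Matrix.add_apply, Matrix.one_apply,
    Subtype.ext_iff, Matrix.of_apply]

/-- A finite digraph with a directed cycle has a nonempty set of vertices in which every vertex has
exactly one out-neighbour. -/
theorem exists_finset_unique_adj [Finite V] {G : Digraph V} (hG : ¬ G.IsAcyclicDigraph) :
    ∃ T : Finset V, T.Nonempty ∧ ∀ i ∈ T, ∃! j, j ∈ T ∧ G.Adj i j := by
  classical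
  have := Fintype.ofFinite V
  obtain ⟨v, hv⟩ : ∃ v, Relation.TransGen G.Adj v v := by
    simpa [IsAcyclicDigraph] using hG
  let P : Finset V → Prop := fun T => T.Nonempty ∧ ∀ i ∈ T, ∃ j ∈ T, G.Adj i j
  have hP : ∃ T, P T := by
    refine ⟨Finset.univ.filter fun w => Relation.TransGen G.Adj v w ∧ Relation.TransGen G.Adj w v,
      ⟨v, by simpa⟩, ?_⟩
    intro i hi
    simp only [Finset.mem_filter, Finset.mem_univ, true_and] at hi ⊢
    obtain ⟨j, hij, hj⟩ := Relation.TransGen.head'_iff.1 hi.2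
    exact ⟨j, ⟨hi.1.tail hij, Relation.TransGen.trans_right hj hv⟩, hij⟩
  -- A minimal nonempty set without sinks is the required one.
  obtain ⟨T, hT⟩ := exists_minimal_of_wellFoundedLT P hP
  have hTP : P T := hT.prop
  refine ⟨T, hTP.1, ?_⟩
  -- By minimality, deleting `b` must strand some vertex, whose only out-neighbour in `T` is
  -- therefore `b`. The resulting injective self-map of the finite set `T` is onto, so every vertex
  -- of `T` is stranded by some deletion.
  have hrem : ∀ b ∈ T, ∃ j ∈ T, ∀ k ∈ T, G.Adj j k → k = b := by
    intro b hb
    by_contra! hcon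
    obtain ⟨k, hk, -, hkb⟩ := hcon b hb
    have hPe : P (T.erase b) := by
      refine ⟨⟨k, Finset.mem_erase.2 ⟨hkb, hk⟩⟩, fun i hi => ?_⟩
      obtain ⟨k, hk, hik, hkb⟩ := hcon i (Finset.mem_of_mem_erase hi)
      exact ⟨k, Finset.mem_erase.2 ⟨hkb, hk⟩, hik⟩
    exact Finset.notMem_erase b T (hT.le_of_le hPe (Finset.erase_subset b T) hb)
  choose! f hfT hf using hrem
  have hinj : Set.InjOn f T := by
    intro a ha b hb hab
    obtain ⟨k, hk, hadj⟩ := hTP.2 _ (hfT a ha)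
    rw [← hf a ha k hk hadj, hf b hb k hk (hab ▸ hadj)]
  have hsurj : Set.SurjOn f T T := Finset.surjOn_of_injOn_of_card_le f hfT hinj le_rfl
  intro i hi
  obtain ⟨b, hb, rfl⟩ := hsurj hi
  obtain ⟨k, hk, hadj⟩ := hTP.2 _ hi
  exact ⟨k, ⟨hk, hadj⟩, fun l hl => by rw [hf b hb l hl.1 hl.2, hf b hb k hk hadj]⟩

theorem isAcyclicDigraph_of_mem {n : ℕ} {G : Digraph (Fin n)}
    (h : 1 + G.adjMatrixZ2 ∈ principalMinorsOne n) : G.IsAcyclicDigraph := by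
  by_contra hG
  obtain ⟨T, ⟨i₀, hi₀⟩, hT⟩ := exists_finset_unique_adj hG
  have hdet := h T
  set N := (1 + G.adjMatrixZ2).submatrix (fun i : T => (i : Fin n)) (fun i : T => (i : Fin n))
  -- Each row sums to 1 + 1 = 0: one from the identity, one from the unique out-neighbour.
  have hz : N.mulVec 1 = 0 := by
    ext i
    obtain ⟨j, hj, huniq⟩ := hT i i.2
    have h1 : ∑ k : T, (1 : Matrix (Fin n) (Fin n) (ZMod 2)) i k = 1 := by
      rw [Finset.sum_eq_single i]
      · simp
      · intro k _ hk
        exact Matrix.one_apply_ne fun h => hk (Subtype.ext h.symm)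
      · simp
    have h2 : ∑ k : T, G.adjMatrixZ2 i k = 1 := by
      rw [Finset.sum_eq_single ⟨j, hj.1⟩]
      · simp [adjMatrixZ2, hj.2]
      · intro k _ hk
        have : ¬ G.Adj i k := fun h => hk (Subtype.ext (huniq k ⟨k.2, h⟩))
        simp [adjMatrixZ2, this]
      · simp
    have : N.mulVec 1 i = ∑ k : T, ((1 : Matrix (Fin n) (Fin n) (ZMod 2)) i k
        + G.adjMatrixZ2 i k) := by
      simp [Matrix.mulVec, dotProduct, N]
    rw [this, Finset.sum_add_distrib, h1, h2]
    exact CharTwo.add_self_eq_zero (1 : ZMod 2)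
  have := Matrix.eq_zero_of_mulVec_eq_zero (by rw [hdet]; exact one_ne_zero) hz
  exact one_ne_zero (congrFun this ⟨i₀, hi₀⟩)

theorem bijOn_one_add_adjMatrixZ2 (n : ℕ) :
    Set.BijOn (fun G : Digraph (Fin n) => 1 + G.adjMatrixZ2)
        {G | G.IsAcyclicDigraph} (principalMinorsOne n) := by
  classical
  refine ⟨fun G hG => one_add_adjMatrixZ2_mem hG, fun G _ H _ h => ?_, fun B hB => ?_⟩
  · have h' := add_left_cancel h
    ext i j
    have := congrFun (congrFun h' i) j
    simp only [adjMatrixZ2, Matrix.of_apply] at this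
    by_cases h1 : G.Adj i j <;> by_cases h2 : H.Adj i j <;> simp_all
  · have hadj : 1 + adjMatrixZ2 (⟨fun i j => (1 + B) i j = 1⟩ : Digraph (Fin n)) = B := by
      have hA : adjMatrixZ2 (⟨fun i j => (1 + B) i j = 1⟩ : Digraph (Fin n)) = 1 + B := by
        ext i j
        have : ∀ a : ZMod 2, (if a = 1 then 1 else 0) = a := by decide
        simp only [adjMatrixZ2, Matrix.of_apply]
        convert! this _
      rw [hA, ← add_assoc]
      have : (1 + 1 : Matrix (Fin n) (Fin n) (ZMod 2)) = 0 := by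
        ext i j
        exact CharTwo.add_self_eq_zero ((1 : Matrix (Fin n) (Fin n) (ZMod 2)) i j)
      rw [this, zero_add]
    refine ⟨_, isAcyclicDigraph_of_mem (hadj.symm ▸ hB), hadj⟩

end Digraph

/-! ### Subgroups of ℤ₂ⁿ and isotropy in standard charts -/

namespace Z2

variable {n : ℕ}

theorem mem_zmultiples_iff {a b : Z2 n} : b ∈ AddSubgroup.zmultiples a ↔ b = 0 ∨ b = a := by
  rw [AddSubgroup.mem_zmultiples_iff]
  constructor
  · rintro ⟨k, rfl⟩
    rcases Int.even_or_odd k with ⟨m, rfl⟩ | ⟨m, rfl⟩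
    · left
      rw [add_zsmul]
      ext i
      exact CharTwo.add_self_eq_zero _
    · right
      rw [add_zsmul, two_mul, add_zsmul, one_zsmul]
      ext i
      simp only [Pi.add_apply]
      rw [CharTwo.add_self_eq_zero, zero_add]
  · rintro (rfl | rfl)
    · exact ⟨0, zero_zsmul a⟩
    · exact ⟨1, one_zsmul b⟩

/-- A cyclic subgroup of ℤ₂ⁿ has at most one nonzero element. Hence isotropy groups determine the
columns of Λ as vectors. -/
theorem zmultiples_injective :
    Function.Injective (AddSubgroup.zmultiples : Z2 n → AddSubgroup (Z2 n)) := by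
  intro a b h
  have ha : a ∈ AddSubgroup.zmultiples b := h ▸ AddSubgroup.mem_zmultiples a
  have hb : b ∈ AddSubgroup.zmultiples a := h ▸ AddSubgroup.mem_zmultiples b
  rcases mem_zmultiples_iff.1 ha with rfl | h
  · rcases mem_zmultiples_iff.1 hb with h | h <;> exact h.symm
  · exact h

theorem natCard_zmultiples {a : Z2 n} (ha : a ≠ 0) : Nat.card (AddSubgroup.zmultiples a) = 2 := by
  rw [Nat.card_zmultiples]
  refine addOrderOf_eq_prime ?_ ha
  ext i
  simp [CharTwo.two_eq_zero]

theorem exists_eq_zmultiples {H : AddSubgroup (Z2 n)} (hH : Nat.card H = 2) :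
    ∃ a, H = AddSubgroup.zmultiples a := by
  have hne : H ≠ ⊥ := by
    rintro rfl
    simp at hH
  obtain ⟨a, haH, ha⟩ := H.bot_or_exists_ne_zero.resolve_left hne
  refine ⟨a, (AddSubgroup.eq_of_le_of_card_ge ?_ ?_).symm⟩
  · rwa [AddSubgroup.zmultiples_le]
  · rw [hH, natCard_zmultiples ha]

theorem natCard_supported (P : Fin n → Prop) :
    Nat.card {c : Z2 n // ∀ i, c i = 0 ∨ P i} = 2 ^ Set.ncard {i | P i} := by
  classical
  have e : {c : Z2 n | ∀ i, c i = 0 ∨ P i} =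
      (Fintype.piFinset fun i => if P i then (Finset.univ : Finset (ZMod 2)) else {0} :
        Finset (Z2 n)) := by
    ext c
    simp only [Set.mem_ofPred_eq, Finset.mem_coe, Fintype.mem_piFinset]
    refine forall_congr' fun i => ?_
    by_cases h : P i <;> simp [h]
  have h1 : Nat.card {c : Z2 n // ∀ i, c i = 0 ∨ P i} =
      Set.ncard {c : Z2 n | ∀ i, c i = 0 ∨ P i} := rfl
  rw [h1, e, Set.ncard_coe_finset, Fintype.card_piFinset, Set.ncard_eq_toFinset_card',
    Set.toFinset_ofPred]
  have : ∀ i, (if P i then (Finset.univ : Finset (ZMod 2)) else {0}).card =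
      if P i then 2 else 1 := by
    intro i
    by_cases h : P i <;> simp [h, ZMod.card]
  simp [this, Finset.prod_ite]

end Z2

theorem stdAct_apply {n : ℕ} (t : Z2 n) (y : EuclideanSpace ℝ (Fin n)) (i : Fin n) :
    stdAct t y i = (-1 : ℝ) ^ (t i).val * y i := rfl

theorem neg_one_pow_val_zero : (-1 : ℝ) ^ (0 : ZMod 2).val = 1 := by simp

theorem neg_one_pow_val_one : (-1 : ℝ) ^ (1 : ZMod 2).val = -1 := by simp [ZMod.val_one]

theorem ZMod.eq_zero_or_eq_one (a : ZMod 2) : a = 0 ∨ a = 1 := by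
  revert a; decide

theorem stdAct_eq_self_iff {n : ℕ} {t : Z2 n} {y : EuclideanSpace ℝ (Fin n)} :
    stdAct t y = y ↔ ∀ i, t i = 0 ∨ y i = 0 := by
  rw [PiLp.ext_iff]
  refine forall_congr' fun i => ?_
  rw [stdAct_apply]
  rcases ZMod.eq_zero_or_eq_one (t i) with h | h
  · simp [h]
  · rw [h, neg_one_pow_val_one]
    simp only [one_ne_zero, false_or]
    constructor <;> intro h <;> linarith

theorem mem_stabilizer_iff_of_chart {n : ℕ} {M : Type*} [TopologicalSpace M] [AddAction (Z2 n) M]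
    {θ : Z2 n ≃+ Z2 n}
    {f : OpenPartialHomeomorph M (EuclideanSpace ℝ (Fin n))}
    (hf : ∀ (t : Z2 n), ∀ y ∈ f.source, t +ᵥ y ∈ f.source ∧ f (t +ᵥ y) = stdAct (θ t) (f y))
    {x : M} (hx : x ∈ f.source) {t : Z2 n} :
    t ∈ AddAction.stabilizer (Z2 n) x ↔ ∀ i, θ t i = 0 ∨ f x i = 0 := by
  rw [AddAction.mem_stabilizer_iff, ← stdAct_eq_self_iff, ← (hf t x hx).2]
  exact (f.injOn.eq_iff (hf t x hx).1 hx).symm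

/-! ### Facets and vertices of the cube -/

namespace Cube

variable {n : ℕ}

/-- The coordinate that is constant on a facet. -/
def facetIndex (F : Fin n ⊕ Fin n) : Fin n := Sum.elim id id F

/-- The value of the constant coordinate on a facet. -/
def facetValue (F : Fin n ⊕ Fin n) : unitInterval := Sum.elim (fun _ => 0) (fun _ => 1) F

theorem mem_facet_iff {F : Fin n ⊕ Fin n} {p : Cube n} :
    p ∈ facet F ↔ p (facetIndex F) = facetValue F := by
  cases F <;> rfl

theorem mem_facetInterior_iff {F : Fin n ⊕ Fin n} {p : Cube n} :
    p ∈ facetInterior F ↔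
      p (facetIndex F) = facetValue F ∧ ∀ i, i ≠ facetIndex F → p i ≠ 0 ∧ p i ≠ 1 := by
  simp only [facetInterior, Set.mem_ofPred_eq, mem_facet_iff]
  refine and_congr_right fun h => ?_
  constructor
  · intro h' i hi
    refine ⟨h' (Sum.inl i) ?_, h' (Sum.inr i) ?_⟩ <;>
    · rintro rfl
      exact hi rfl
  · rintro h' (i | i) hF <;> intro hp <;> simp only [facetIndex, facetValue, Sum.elim_inl,
      Sum.elim_inr, id] at hp
    · rcases F with j | j <;> simp only [facetIndex, facetValue, Sum.elim_inl,
        Sum.elim_inr, id] at h h'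
      · exact (h' i (fun e => hF (e ▸ rfl))).1 hp
      · by_cases e : i = j
        · subst e; simp [h] at hp
        · exact (h' i e).1 hp
    · rcases F with j | j <;> simp only [facetIndex, facetValue, Sum.elim_inl,
        Sum.elim_inr, id] at h h'
      · by_cases e : i = j
        · subst e; simp [h] at hp
        · exact (h' i e).2 hp
      · exact (h' i (fun e => hF (e ▸ rfl))).2 hp

open scoped Classical in
theorem facetInterior_eq_pi (F : Fin n ⊕ Fin n) :
    facetInterior F =
      Set.univ.pi fun i => if i = facetIndex F then {facetValue F} else Set.Ioo 0 1 := by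
  ext p
  simp only [mem_facetInterior_iff, Set.mem_univ_pi]
  constructor
  · rintro ⟨h, h'⟩ i
    split_ifs with hi
    · subst hi; exact h
    · exact ⟨unitInterval.pos_iff_ne_zero.2 (h' i hi).1,
        unitInterval.lt_one_iff_ne_one.2 (h' i hi).2⟩
  · intro h
    refine ⟨by simpa using h (facetIndex F), fun i hi => ?_⟩
    have := h i
    rw [if_neg hi] at this
    exact ⟨this.1.ne', this.2.ne⟩

theorem isPreconnected_facetInterior (F : Fin n ⊕ Fin n) : IsPreconnected (facetInterior F) := by
  classical
  rw [facetInterior_eq_pi]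
  refine isPreconnected_univ_pi fun i => ?_
  split_ifs
  · exact isPreconnected_singleton
  · exact isPreconnected_Ioo

theorem facet_subset_closure (F : Fin n ⊕ Fin n) : facet F ⊆ closure (facetInterior F) := by
  classical
  rw [facetInterior_eq_pi, closure_pi_set]
  intro p hp i _
  dsimp only
  split_ifs with hi
  · subst hi
    exact subset_closure (mem_facet_iff.1 hp)
  · rw [closure_Ioo zero_ne_one]
    exact ⟨unitInterval.nonneg', unitInterval.le_one'⟩

theorem codim_eq (p : Cube n) : p.codim = Set.ncard {i | p i = 0 ∨ p i = 1} := by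
  have h : {i | p i = 0 ∨ p i = 1} = facetIndex '' {F | p ∈ facet F} := by
    ext i
    constructor
    · rintro (h | h)
      · exact ⟨Sum.inl i, h, rfl⟩
      · exact ⟨Sum.inr i, h, rfl⟩
    · rintro ⟨F | F, h, rfl⟩
      · exact Or.inl h
      · exact Or.inr h
  rw [codim, h, Set.InjOn.ncard_image]
  intro F hF F' hF' e
  rw [Set.mem_ofPred_eq, mem_facet_iff] at hF hF'
  rw [e, hF'] at hF
  rcases F with i | i <;> rcases F' with j | j <;>
    simp_all [facetValue, facetIndex]

theorem codim_eq_one_of_mem {F : Fin n ⊕ Fin n} {p : Cube n} (hp : p ∈ facetInterior F) :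
    p.codim = 1 := by
  rw [codim, Set.ncard_eq_one]
  refine ⟨F, Set.eq_singleton_iff_unique_mem.2 ⟨hp.1, fun F' hF' => ?_⟩⟩
  by_contra h
  exact hp.2 F' h hF'

theorem exists_mem_facetInterior {p : Cube n} (hp : p.codim = 1) : ∃ F, p ∈ facetInterior F := by
  rw [codim, Set.ncard_eq_one] at hp
  obtain ⟨F, hF⟩ := hp
  rw [Set.eq_singleton_iff_unique_mem] at hF
  exact ⟨F, hF.1, fun F' hne hF' => hne (hF.2 F' hF')⟩

theorem facetInterior_nonempty (F : Fin n ⊕ Fin n) : (facetInterior F).Nonempty := by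
  have hF : (fun _ => facetValue F) ∈ closure (facetInterior F) :=
    facet_subset_closure F (mem_facet_iff.2 rfl)
  exact closure_nonempty_iff.1 ⟨_, hF⟩

open scoped Classical in
/-- The facet orthogonal to the `j`-th axis through the vertex of the cube whose coordinates equal
to `1` are those in `S`. -/
noncomputable def vertexFacet (S : Set (Fin n)) (j : Fin n) : Fin n ⊕ Fin n :=
  if j ∈ S then Sum.inr j else Sum.inl j

theorem facetIndex_vertexFacet (S : Set (Fin n)) (j : Fin n) :
    facetIndex (vertexFacet S j) = j := by
  unfold vertexFacet
  split_ifs <;> rfl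

end Cube

/-- The submatrix of `Λ` formed by the columns of the facets through a vertex. -/
noncomputable def vertexMatrix {n : ℕ} (Λ : Matrix (Fin n) (Fin n ⊕ Fin n) (ZMod 2))
    (S : Set (Fin n)) : Matrix (Fin n) (Fin n) (ZMod 2) :=
  Λ.submatrix id (Cube.vertexFacet S)

/-! ### Characteristic matrices and nonsingularity at vertices -/

namespace SmallCover

variable {n : ℕ} (X : SmallCover.{u} n)

instance : ContinuousConstVAdd (Z2 n) X.carrier where
  continuous_const_vadd t := (X.smooth_action t).continuous

theorem proj_vadd (t : Z2 n) (x : X.carrier) : X.proj (t +ᵥ x) = X.proj x :=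
  ((X.proj_eq_iff _ _).2 ⟨t, rfl⟩).symm

theorem isOpenMap_proj : IsOpenMap X.proj := by
  intro U hU
  rw [← X.isQuotientMap_proj.isOpen_preimage]
  have : X.proj ⁻¹' (X.proj '' U) = ⋃ t : Z2 n, (fun x => t +ᵥ x) ⁻¹' U := by
    ext x
    simp only [Set.mem_preimage, Set.mem_image, Set.mem_iUnion]
    constructor
    · rintro ⟨y, hy, h⟩
      obtain ⟨t, rfl⟩ := (X.proj_eq_iff _ _).1 h.symm
      exact ⟨t, hy⟩
    · rintro ⟨t, ht⟩
      exact ⟨_, ht, X.proj_vadd t x⟩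
  rw [this]
  exact isOpen_iUnion fun t => hU.preimage (continuous_const_vadd t)

theorem stabilizer_eq_of_proj_eq {x y : X.carrier} (h : X.proj x = X.proj y) :
    AddAction.stabilizer (Z2 n) x = AddAction.stabilizer (Z2 n) y := by
  obtain ⟨t, rfl⟩ := (X.proj_eq_iff _ _).1 h
  ext s
  rw [AddAction.mem_stabilizer_iff, AddAction.mem_stabilizer_iff, vadd_vadd, add_comm, ← vadd_vadd,
    vadd_left_cancel_iff]

/-- The set moved by a given `t` is open, and there are finitely many `t`. -/
theorem eventually_stabilizer_le (x : X.carrier) :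
    ∀ᶠ y in nhds x, AddAction.stabilizer (Z2 n) y ≤ AddAction.stabilizer (Z2 n) x := by
  have h : ∀ t : Z2 n, ∀ᶠ y in nhds x, t +ᵥ y = y → t +ᵥ x = x := by
    intro t
    by_cases ht : t +ᵥ x = x
    · exact Filter.Eventually.of_forall fun _ _ => ht
    · filter_upwards [(isOpen_ne_fun (continuous_const_vadd t) continuous_id).mem_nhds ht]
        with y hy h
      exact absurd h hy
  filter_upwards [Filter.eventually_all.2 h] with y hy t ht
  exact hy t ht

/-- Semicontinuity gives an inclusion nearby, the common order 2 turns it into an equality, and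
connectedness of the facet interior spreads it. -/
theorem stabilizer_eq_of_mem_facetInterior {F : Fin n ⊕ Fin n} {x y : X.carrier}
    (hx : X.proj x ∈ Cube.facetInterior F) (hy : X.proj y ∈ Cube.facetInterior F) :
    AddAction.stabilizer (Z2 n) x = AddAction.stabilizer (Z2 n) y := by
  -- A set-theoretic section suffices: the group is abelian, so isotropy depends only on the orbit.
  choose s hs using X.isQuotientMap_proj.surjective
  have hconst : ∀ p ∈ Cube.facetInterior F, ∀ q ∈ Cube.facetInterior F,
      AddAction.stabilizer (Z2 n) (s p) = AddAction.stabilizer (Z2 n) (s q) := by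
    intro p hp q hq
    refine (Cube.isPreconnected_facetInterior F).induction₂
      (fun p q => AddAction.stabilizer (Z2 n) (s p) = AddAction.stabilizer (Z2 n) (s q))
      ?_ (fun _ _ _ _ _ _ h h' => h.trans h') (fun _ _ _ _ h => h.symm) hp hq
    intro p hp
    have hN : X.proj '' {y | AddAction.stabilizer (Z2 n) y ≤ AddAction.stabilizer (Z2 n) (s p)}
        ∈ nhds p := by
      have := X.isOpenMap_proj.image_mem_nhds (X.eventually_stabilizer_le (s p))
      rwa [hs] at this
    filter_upwards [mem_nhdsWithin_of_mem_nhds hN, self_mem_nhdsWithin] with q hq hqF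
    obtain ⟨y, hy, rfl⟩ := hq
    rw [X.stabilizer_eq_of_proj_eq (hs (X.proj y))]
    refine (AddSubgroup.eq_of_le_of_card_ge hy ?_).symm
    rw [X.card_stabilizer, X.card_stabilizer, hs, Cube.codim_eq_one_of_mem hp,
      Cube.codim_eq_one_of_mem hqF]
  rw [← X.stabilizer_eq_of_proj_eq (hs (X.proj x)), ← X.stabilizer_eq_of_proj_eq (hs (X.proj y))]
  exact hconst _ hx _ hy

theorem exists_isCharMatrix : ∃ Λ, X.IsCharMatrix Λ := by
  have h : ∀ F : Fin n ⊕ Fin n, ∃ a : Z2 n, ∀ x : X.carrier, X.proj x ∈ Cube.facetInterior F →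
      AddAction.stabilizer (Z2 n) x = AddSubgroup.zmultiples a := by
    intro F
    obtain ⟨p, hp⟩ := Cube.facetInterior_nonempty F
    obtain ⟨x, rfl⟩ := X.isQuotientMap_proj.surjective p
    obtain ⟨a, ha⟩ := Z2.exists_eq_zmultiples
      (by rw [X.card_stabilizer x, Cube.codim_eq_one_of_mem hp, pow_one])
    exact ⟨a, fun y hy => by rw [X.stabilizer_eq_of_mem_facetInterior hy hp, ha]⟩
  choose a ha using h
  exact ⟨Matrix.of fun i F => a F i, ha⟩

variable {X} {Λ : Matrix (Fin n) (Fin n ⊕ Fin n) (ZMod 2)}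

theorem IsCharMatrix.unique {Λ' : Matrix (Fin n) (Fin n ⊕ Fin n) (ZMod 2)}
    (hΛ : X.IsCharMatrix Λ) (hΛ' : X.IsCharMatrix Λ') : Λ = Λ' := by
  ext i F
  obtain ⟨p, hp⟩ := Cube.facetInterior_nonempty F
  obtain ⟨x, rfl⟩ := X.isQuotientMap_proj.surjective p
  exact congrFun (Z2.zmultiples_injective ((hΛ F x hp).symm.trans (hΛ' F x hp))) i

/-- Fixed sets are closed, and since π is open and continuous the preimage of the facet interior is
dense in that of the facet. -/
theorem IsCharMatrix.col_vadd (hΛ : X.IsCharMatrix Λ) {F : Fin n ⊕ Fin n} {x : X.carrier}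
    (hx : X.proj x ∈ Cube.facet F) : Λ.col F +ᵥ x = x := by
  have hcl : IsClosed {y : X.carrier | Λ.col F +ᵥ y = y} :=
    isClosed_eq (continuous_const_vadd _) continuous_id
  have hsub : X.proj ⁻¹' Cube.facetInterior F ⊆ {y : X.carrier | Λ.col F +ᵥ y = y} := by
    intro y hy
    rw [Set.mem_ofPred_eq, ← AddAction.mem_stabilizer_iff, hΛ F y hy]
    exact AddSubgroup.mem_zmultiples _
  have hmem : x ∈ closure (X.proj ⁻¹' Cube.facetInterior F) := by
    rw [← X.isOpenMap_proj.preimage_closure_eq_closure_preimage X.isQuotientMap_proj.continuous]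
    exact Cube.facet_subset_closure F hx
  exact closure_minimal hsub hcl hmem

open scoped Classical in
-- A point over the vertex is fixed by the whole group, hence is the origin of its chart. Nearby
-- points on one coordinate hyperplane only lie over interiors of facets through the vertex, so
-- every vector of the basis `θ.symm (Pi.single i 1)` occurs among the columns.
theorem IsCharMatrix.isUnit_vertexMatrix (hΛ : X.IsCharMatrix Λ) (S : Set (Fin n)) :
    IsUnit (vertexMatrix Λ S) := by
  let v : Cube n := fun j => if j ∈ S then 1 else 0
  obtain ⟨x, hx⟩ := X.isQuotientMap_proj.surjective v
  obtain ⟨θ, f, -, hxf, hf⟩ := X.locallyStandard x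
  have hstab : AddAction.stabilizer (Z2 n) x = ⊤ := by
    refine AddSubgroup.eq_top_of_card_eq _ ?_
    rw [X.card_stabilizer, hx, Cube.codim_eq]
    have : {i | v i = 0 ∨ v i = 1} = Set.univ := by
      ext i
      by_cases h : i ∈ S <;> simp [v, h]
    rw [this, Set.ncard_univ]
    simp [Nat.card_eq_fintype_card, ZMod.card]
  have hfx : f x = 0 := by
    ext i
    have : θ.symm (Pi.single i 1) ∈ AddAction.stabilizer (Z2 n) x := hstab ▸ AddSubgroup.mem_top _
    have := (mem_stabilizer_iff_of_chart hf hxf).1 this i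
    simpa using this
  -- Near the vertex one avoids the facets that do not pass through it.
  have hU : ∀ᶠ p in nhds v, ∀ j, p j ≠ if j ∈ S then 0 else 1 := by
    rw [Filter.eventually_all]
    intro j
    refine (isOpen_ne_fun (continuous_apply j) continuous_const).mem_nhds ?_
    by_cases h : j ∈ S <;> simp [v, h]
  have hev : ∀ᶠ y in nhds (0 : EuclideanSpace ℝ (Fin n)), y ∈ f.target ∧
      ∀ j, X.proj (f.symm y) j ≠ if j ∈ S then 0 else 1 := by
    have h0 : (0 : EuclideanSpace ℝ (Fin n)) ∈ f.target := hfx ▸ f.map_source hxf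
    have hc : Filter.Tendsto (fun y => X.proj (f.symm y)) (nhds 0) (nhds v) := by
      have h1 : Filter.Tendsto f.symm (nhds 0) (nhds x) := by
        have := f.continuousAt_symm h0
        rwa [ContinuousAt, ← hfx, f.left_inv hxf, hfx] at this
      have := X.isQuotientMap_proj.continuous.tendsto x
      rw [hx] at this
      exact this.comp h1
    exact Filter.Eventually.and (f.open_target.mem_nhds h0) (hc.eventually hU)
  have hcol : ∀ i, ∃ j, θ.symm (Pi.single i 1) = (vertexMatrix Λ S).col j := by
    intro i
    let w : EuclideanSpace ℝ (Fin n) := WithLp.toLp 2 fun k => if k = i then 0 else 1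
    have ht : Filter.Tendsto (fun r : ℝ => r • w) (nhdsWithin 0 (Set.Ioi 0)) (nhds 0) := by
      have : Continuous fun r : ℝ => r • w := by fun_prop
      have := (this.tendsto 0).mono_left (nhdsWithin_le_nhds (s := Set.Ioi 0))
      simpa using this
    obtain ⟨r, ⟨hrt, hrv⟩, hr⟩ := ((ht.eventually hev).and self_mem_nhdsWithin).exists
    have hr : 0 < r := hr
    set z := f.symm (r • w)
    have hz : z ∈ f.source := f.map_target hrt
    have hfz : f z = r • w := f.right_inv hrt
    have hst : AddAction.stabilizer (Z2 n) z = AddSubgroup.zmultiples (θ.symm (Pi.single i 1)) := by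
      ext t
      rw [mem_stabilizer_iff_of_chart hf hz, Z2.mem_zmultiples_iff, hfz,
        AddEquiv.eq_symm_apply]
      have h1 : ∀ k, (r • w) k = 0 ↔ k = i := by
        intro k
        simp [w, hr.ne']
      simp only [h1]
      constructor
      · intro h
        rcases ZMod.eq_zero_or_eq_one (θ t i) with hi | hi
        · left
          rw [← map_eq_zero_iff θ θ.injective]
          ext k
          by_cases hk : k = i
          · rw [hk, hi]; rfl
          · exact (h k).resolve_right hk
        · right
          ext k
          by_cases hk : k = i
          · rw [hk, hi, Pi.single_eq_same]
          · rw [(h k).resolve_right hk, Pi.single_eq_of_ne hk]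
      · rintro (rfl | h) k
        · left; simp
        · by_cases hk : k = i
          · exact Or.inr hk
          · left; rw [h, Pi.single_eq_of_ne hk]
    have hcodim : (X.proj z).codim = 1 := by
      have h := X.card_stabilizer z
      rw [hst, Z2.natCard_zmultiples] at h
      · exact (Nat.pow_right_injective le_rfl (h.symm.trans (pow_one 2).symm))
      · rw [Ne, map_eq_zero_iff _ θ.symm.injective]
        exact fun h => one_ne_zero (Pi.single_eq_zero_iff.1 h)
    obtain ⟨F, hF⟩ := Cube.exists_mem_facetInterior hcodim
    have hFv : F = Cube.vertexFacet S (Cube.facetIndex F) := by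
      have h1 := Cube.mem_facet_iff.1 hF.1
      have h2 := hrv (Cube.facetIndex F)
      rw [h1] at h2
      unfold Cube.vertexFacet
      rcases F with j | j <;> by_cases hj : j ∈ S <;>
        simp_all [Cube.facetIndex, Cube.facetValue]
    refine ⟨Cube.facetIndex F, ?_⟩
    rw [hΛ F z hF] at hst
    have := Z2.zmultiples_injective hst
    rw [← this]
    ext k
    rw [hFv]
    simp [vertexMatrix, Matrix.col, Cube.facetIndex_vertexFacet]
  rw [← Matrix.mulVec_surjective_iff_isUnit]
  choose j hj using hcol
  intro t
  refine ⟨∑ i, θ t i • Pi.single (j i) 1, ?_⟩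
  rw [Matrix.mulVec_sum]
  have h1 : ∀ i, (vertexMatrix Λ S).mulVec (θ t i • Pi.single (j i) 1) =
      θ.symm (Pi.single i (θ t i)) := by
    intro i
    rw [Matrix.mulVec_smul, Matrix.mulVec_single_one, ← hj]
    rcases ZMod.eq_zero_or_eq_one (θ t i) with hi | hi <;> simp [hi]
  rw [Finset.sum_congr rfl fun i _ => h1 i, ← map_sum, Finset.univ_sum_single, θ.symm_apply_apply]

/-- The columns of the facets through π(x) fix x and are independent, so they span a subgroup of
order `2 ^ codim`, which is the order of the isotropy group. The vertex given by `S` lies on the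
minimal face of π(x); on the interior coordinates its choice is immaterial because `c` vanishes
there. -/
theorem IsCharMatrix.mem_stabilizer_iff (hΛ : X.IsCharMatrix Λ) {x : X.carrier} {t : Z2 n} :
    t ∈ AddAction.stabilizer (Z2 n) x ↔
      ∃ c : Z2 n, (∀ i, c i = 0 ∨ (X.proj x i = 0 ∨ X.proj x i = 1)) ∧
        (vertexMatrix Λ {j | X.proj x j = 1}).mulVec c = t := by
  set S := {j | X.proj x j = 1} with hS
  set P : Fin n → Prop := fun i => X.proj x i = 0 ∨ X.proj x i = 1 with hP
  have hsub : ∀ c : Z2 n, (∀ i, c i = 0 ∨ P i) →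
      (vertexMatrix Λ S).mulVec c ∈ AddAction.stabilizer (Z2 n) x := by
    intro c hc
    have : (vertexMatrix Λ S).mulVec c = ∑ j, c j • (vertexMatrix Λ S).col j := by
      ext i
      simp [Matrix.mulVec, dotProduct, Matrix.col, mul_comm]
    rw [this]
    refine AddSubgroup.sum_mem _ fun j _ => ?_
    rcases ZMod.eq_zero_or_eq_one (c j) with h | h
    · rw [h, zero_smul]; exact zero_mem _
    · rw [h, one_smul]
      refine hΛ.col_vadd (F := Cube.vertexFacet S j) ?_
      have hPj := (hc j).resolve_left (by rw [h]; exact one_ne_zero)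
      unfold Cube.vertexFacet
      split_ifs with hj
      · exact hj
      · exact hPj.resolve_right hj
  let g : {c : Z2 n // ∀ i, c i = 0 ∨ P i} → AddAction.stabilizer (Z2 n) x :=
    fun c => ⟨_, hsub c c.2⟩
  have hg : Function.Injective g := by
    intro c d h
    exact Subtype.ext (Matrix.mulVec_injective_of_isUnit (hΛ.isUnit_vertexMatrix S)
      (Subtype.ext_iff.1 h))
  have hbij := (Nat.bijective_iff_injective_and_card g).2
    ⟨hg, by rw [Z2.natCard_supported, X.card_stabilizer, Cube.codim_eq]⟩
  constructor
  · intro ht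
    obtain ⟨c, hc⟩ := hbij.2 ⟨t, ht⟩
    exact ⟨c, c.2, Subtype.ext_iff.1 hc⟩
  · rintro ⟨c, hc, rfl⟩
    exact hsub c hc

end SmallCover

/-- Columns outside `S` are those of the identity, so listing `S` first makes the matrix block
triangular. -/
theorem det_vertexMatrix_fromCols_one {n : ℕ} (B : Matrix (Fin n) (Fin n) (ZMod 2))
    (S : Finset (Fin n)) :
    (vertexMatrix (Matrix.fromCols 1 B) S).det =
      (B.submatrix (fun i : S => (i : Fin n)) (fun i : S => (i : Fin n))).det := by
  classical
  let e : {i // i ∈ S} ⊕ {i // i ∉ S} ≃ Fin n := Equiv.sumCompl (· ∈ S)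
  rw [← Matrix.det_submatrix_equiv_self e]
  have : (vertexMatrix (Matrix.fromCols 1 B) S).submatrix e e =
      Matrix.fromBlocks (B.submatrix (fun i : S => (i : Fin n)) (fun i : S => (i : Fin n))) 0
        (B.submatrix (fun i : {i // i ∉ S} => (i : Fin n)) (fun i : S => (i : Fin n))) 1 := by
    ext i j
    rcases i with i | i <;> rcases j with j | j <;>
      simp [vertexMatrix, Cube.vertexFacet, e, j.2, Matrix.one_apply, Subtype.ext_iff]
    rintro h
    exact j.2 (h ▸ i.2)
  rw [this, Matrix.det_fromBlocks_zero₁₂, Matrix.det_one, mul_one]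

theorem vertexMatrix_mul {n : ℕ} (A : Matrix (Fin n) (Fin n) (ZMod 2))
    (Λ : Matrix (Fin n) (Fin n ⊕ Fin n) (ZMod 2)) (S : Set (Fin n)) :
    vertexMatrix (A * Λ) S = A * vertexMatrix Λ S := by
  ext i j
  rfl

theorem mem_principalMinorsOne_iff {n : ℕ} {B : Matrix (Fin n) (Fin n) (ZMod 2)} :
    B ∈ principalMinorsOne n ↔
      ∀ S : Set (Fin n), IsUnit (vertexMatrix (Matrix.fromCols 1 B) S) := by
  classical
  have h1 : ∀ a : ZMod 2, IsUnit a ↔ a = 1 := by decide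
  constructor
  · intro h S
    rw [Matrix.isUnit_iff_isUnit_det, h1, ← Set.coe_toFinset S, det_vertexMatrix_fromCols_one]
    exact h _
  · intro h S
    rw [← det_vertexMatrix_fromCols_one, ← h1, ← Matrix.isUnit_iff_isUnit_det]
    exact h _

/-! ### Invariance of A⁻¹B under D-J equivalence -/

namespace SmallCover

variable {n : ℕ} {X Y : SmallCover.{u} n} {Λ Λ' : Matrix (Fin n) (Fin n ⊕ Fin n) (ZMod 2)}

theorem IsCharMatrix.isUnit_toCols₁ (hΛ : X.IsCharMatrix Λ) : IsUnit Λ.toCols₁.det := by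
  rw [← Matrix.isUnit_iff_isUnit_det]
  convert! hΛ.isUnit_vertexMatrix ∅
  ext i j
  simp [vertexMatrix, Cube.vertexFacet]

theorem IsCharMatrix.eq_mul (hΛ : X.IsCharMatrix Λ) :
    Λ = Λ.toCols₁ * Matrix.fromCols 1 (Λ.toCols₁⁻¹ * Λ.toCols₂) := by
  rw [Matrix.mul_fromCols, mul_one, Matrix.mul_nonsing_inv_cancel_left _ _ hΛ.isUnit_toCols₁,
    Matrix.fromCols_toCols]

theorem IsCharMatrix.mem_principalMinorsOne (hΛ : X.IsCharMatrix Λ) :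
    Λ.toCols₁⁻¹ * Λ.toCols₂ ∈ principalMinorsOne n := by
  rw [mem_principalMinorsOne_iff]
  intro S
  have h := hΛ.isUnit_vertexMatrix S
  rw [hΛ.eq_mul, vertexMatrix_mul] at h
  exact isUnit_of_mul_isUnit_right h

/-- An additive automorphism of ℤ₂ⁿ is automatically linear, hence given by a matrix; it carries
isotropy groups of X to those of Y. -/
theorem IsCharMatrix.mul_of_equivariant (hΛ : X.IsCharMatrix Λ) (φ : Z2 n ≃+ Z2 n)
    (f : X.carrier ≃ Y.carrier) (hf : ∀ (t : Z2 n) (x : X.carrier), f (t +ᵥ x) = φ t +ᵥ f x)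
    (hp : ∀ x, Y.proj (f x) = X.proj x) :
    Y.IsCharMatrix (LinearMap.toMatrix' (φ.toAddMonoidHom.toZModLinearMap 2) * Λ) := by
  intro F y hy
  obtain ⟨x, rfl⟩ := f.surjective y
  rw [hp] at hy
  have hcol : (fun i => (LinearMap.toMatrix' (φ.toAddMonoidHom.toZModLinearMap 2) * Λ) i F) =
      φ (Λ.col F) := by
    have := LinearMap.toMatrix'_mulVec (φ.toAddMonoidHom.toZModLinearMap 2) (Λ.col F)
    exact this
  rw [hcol]
  ext t
  rw [AddAction.mem_stabilizer_iff]
  obtain ⟨s, rfl⟩ := φ.surjective t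
  rw [← hf, f.injective.eq_iff, ← AddAction.mem_stabilizer_iff, hΛ F x hy,
    Z2.mem_zmultiples_iff, Z2.mem_zmultiples_iff, map_eq_zero_iff φ φ.injective,
    φ.injective.eq_iff]
  rfl

theorem inv_mul_eq_of_djEquiv (h : X.DJEquiv Y) (hΛ : X.IsCharMatrix Λ) (hΛ' : Y.IsCharMatrix Λ') :
    Λ.toCols₁⁻¹ * Λ.toCols₂ = Λ'.toCols₁⁻¹ * Λ'.toCols₂ := by
  obtain ⟨φ, f, hf, hp⟩ := h
  set P := LinearMap.toMatrix' (φ.toAddMonoidHom.toZModLinearMap 2)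
  have e : Λ' = P * Λ := hΛ'.unique (hΛ.mul_of_equivariant φ f.toEquiv hf hp)
  have h1 : Λ'.toCols₁ = P * Λ.toCols₁ := by rw [e]; rfl
  have h2 : Λ'.toCols₂ = P * Λ.toCols₂ := by rw [e]; rfl
  have hP : IsUnit P.det := by
    have := hΛ'.isUnit_toCols₁
    rw [h1, Matrix.det_mul] at this
    exact isUnit_of_mul_isUnit_left this
  rw [h1, h2, Matrix.mul_inv_rev, mul_assoc, Matrix.nonsing_inv_mul_cancel_left _ _ hP]

end SmallCover

/-! ### Topology of the open cube -/

namespace Cube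

variable {n : ℕ}

/-- The interior of the cube: the points that lie on no facet. -/
def openCube (n : ℕ) : Set (Cube n) := Set.univ.pi fun _ => Set.Ioo 0 1

theorem mem_openCube_iff {p : Cube n} : p ∈ openCube n ↔ ∀ i, p i ≠ 0 ∧ p i ≠ 1 := by
  simp only [openCube, Set.mem_univ_pi, Set.mem_Ioo, unitInterval.pos_iff_ne_zero,
    unitInterval.lt_one_iff_ne_one]

theorem closure_openCube : closure (openCube n) = Set.univ := by
  rw [openCube, closure_pi_set, Set.eq_univ_iff_forall]
  intro p i _
  dsimp only
  rw [closure_Ioo zero_ne_one]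
  exact ⟨unitInterval.nonneg', unitInterval.le_one'⟩

theorem codim_eq_zero_iff {p : Cube n} : p.codim = 0 ↔ p ∈ openCube n := by
  rw [codim_eq, Set.ncard_eq_zero, mem_openCube_iff, Set.eq_empty_iff_forall_notMem]
  simp only [Set.mem_ofPred_eq, not_or, ne_eq]

/-- The interior of the cube as a convex subset of `ℝⁿ`. -/
def openCubeHomeomorph (n : ℕ) :
    openCube n ≃ₜ (Set.univ.pi fun _ => Set.Ioo 0 1 : Set (Fin n → ℝ)) where
  toFun p := ⟨fun i => p.1 i, fun i hi => ⟨(p.2 i hi).1, (p.2 i hi).2⟩⟩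
  invFun q := ⟨fun i => ⟨q.1 i, (q.2 i trivial).1.le, (q.2 i trivial).2.le⟩,
    fun i hi => ⟨(q.2 i hi).1, (q.2 i hi).2⟩⟩
  left_inv _ := rfl
  right_inv _ := rfl
  continuous_toFun := (continuous_pi fun i => continuous_subtype_val.comp
    ((continuous_apply i).comp continuous_subtype_val)).subtype_mk _
  continuous_invFun := (continuous_pi fun i =>
    ((continuous_apply i).comp continuous_subtype_val).subtype_mk _).subtype_mk _

theorem convex_pi_Ioo (n : ℕ) :
    Convex ℝ (Set.univ.pi fun _ => Set.Ioo 0 1 : Set (Fin n → ℝ)) :=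
  convex_pi fun _ _ => convex_Ioo 0 1

instance : SimplyConnectedSpace (openCube n) := by
  have : ContractibleSpace (Set.univ.pi fun _ => Set.Ioo 0 1 : Set (Fin n → ℝ)) :=
    (convex_pi_Ioo n).contractibleSpace ⟨fun _ => 1 / 2, fun _ _ => by norm_num⟩
  have : ContractibleSpace (openCube n) := (openCubeHomeomorph n).contractibleSpace
  infer_instance

instance : LocallyPathConnectedSpace (openCube n) := by
  have := (convex_pi_Ioo n).locallyPathConnectedSpace
  exact (openCubeHomeomorph n).isOpenEmbedding.locallyPathConnectedSpace

end Cube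

theorem dist_stdAct {n : ℕ} (t : Z2 n) (y z : EuclideanSpace ℝ (Fin n)) :
    dist (stdAct t y) (stdAct t z) = dist y z := by
  rw [EuclideanSpace.dist_eq, EuclideanSpace.dist_eq]
  congr 1
  refine Finset.sum_congr rfl fun i _ => ?_
  rw [stdAct_apply, stdAct_apply]
  rcases ZMod.eq_zero_or_eq_one (t i) with h | h
  · simp [h]
  · rw [h, neg_one_pow_val_one, neg_one_mul, neg_one_mul, dist_neg_neg]

/-! ### A continuous section of the orbit map -/

namespace SmallCover

variable {n : ℕ} (X : SmallCover.{u} n)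

theorem stabilizer_eq_bot_iff {x : X.carrier} :
    AddAction.stabilizer (Z2 n) x = ⊥ ↔ X.proj x ∈ Cube.openCube n := by
  rw [← Cube.codim_eq_zero_iff, ← AddSubgroup.card_eq_one, X.card_stabilizer]
  simp

/-- Over the open cube the finite group acts freely, so π is a covering there, and the inclusion of
a simply connected, locally path-connected space lifts. -/
theorem exists_section_openCube :
    ∃ s : C(Cube.openCube n, X.carrier), ∀ p, X.proj (s p) = p := by
  have hcov := X.isQuotientMap_proj.isCoveringMapOn_of_properlyDiscontinuousVAdd (G := Z2 n)
    (fun {x y} => by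
      rw [eq_comm, X.proj_eq_iff]
      rfl)
  let p₀ : Cube.openCube n := Nonempty.some inferInstance
  obtain ⟨x₀, hx₀⟩ := X.isQuotientMap_proj.surjective p₀
  obtain ⟨s, ⟨-, hs⟩, -⟩ := hcov.existsUnique_continuousMap_lifts
    (⟨Subtype.val, continuous_subtype_val⟩ : C(Cube.openCube n, Cube n)) (a₀ := p₀) (e₀ := x₀) hx₀
    (fun p => by
      obtain ⟨x, hx⟩ := X.isQuotientMap_proj.surjective p
      exact ⟨x, X.stabilizer_eq_bot_iff.2 (hx ▸ p.2), hx⟩)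
  exact ⟨s, fun p => congrFun hs p⟩

variable {X}

section Chamber

variable {s : C(Cube.openCube n, X.carrier)}

theorem proj_mem_openCube (hs : ∀ p, X.proj (s p) = p) {x : X.carrier} (hx : x ∈ Set.range s) :
    X.proj x ∈ Cube.openCube n := by
  obtain ⟨p, rfl⟩ := hx
  rw [hs]
  exact p.2

theorem eq_zero_of_mem_range (hs : ∀ p, X.proj (s p) = p)
    {x : X.carrier} {t : Z2 n} (hx : x ∈ Set.range s)
    (htx : t +ᵥ x ∈ Set.range s) : t = 0 := by
  have hstab := X.stabilizer_eq_bot_iff.2 (proj_mem_openCube hs hx)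
  obtain ⟨p, rfl⟩ := hx
  obtain ⟨q, hq⟩ := htx
  have hpq : q = p := by
    have := congrArg X.proj hq
    rw [X.proj_vadd, hs, hs] at this
    exact Subtype.ext this
  rw [hpq] at hq
  have : t ∈ AddAction.stabilizer (Z2 n) (s p) := hq.symm
  rwa [hstab, AddSubgroup.mem_bot] at this

/-- Over the open cube the space is the disjoint union of the finitely many closed translates `D t`
of the chamber `Set.range s`, so the chamber is clopen there. -/
theorem subset_range_of_isPreconnected (hs : ∀ p, X.proj (s p) = p)
    {K : Set X.carrier} (hK : IsPreconnected K)
    (hKo : ∀ x ∈ K, X.proj x ∈ Cube.openCube n) {a : X.carrier} (haK : a ∈ K)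
    (ha : a ∈ Set.range s) : K ⊆ Set.range s := by
  let E : Set X.carrier := X.proj ⁻¹' Cube.openCube n
  let D : Z2 n → Set E := fun t => {x | t +ᵥ s ⟨X.proj x.1, x.2⟩ = x.1}
  have hDcl : ∀ t, IsClosed (D t) := by
    intro t
    have hc : Continuous fun x : E => (⟨X.proj x.1, x.2⟩ : Cube.openCube n) :=
      (X.isQuotientMap_proj.continuous.comp continuous_subtype_val).subtype_mk _
    exact isClosed_eq ((continuous_const_vadd t).comp (s.continuous.comp hc))
      continuous_subtype_val
  have hD0 : D 0 = (⋃ t : {t : Z2 n // t ≠ 0}, D t)ᶜ := by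
    ext x
    simp only [Set.mem_compl_iff, Set.mem_iUnion, not_exists, D, Set.mem_ofPred_eq]
    have hx := X.stabilizer_eq_bot_iff.2 x.2
    constructor
    · intro h0 t ht
      rw [zero_vadd] at h0
      rw [h0] at ht
      have : t.1 ∈ AddAction.stabilizer (Z2 n) x.1 := ht
      rw [hx, AddSubgroup.mem_bot] at this
      exact t.2 this
    · intro h
      obtain ⟨t, ht⟩ := (X.proj_eq_iff (s ⟨X.proj x.1, x.2⟩) x.1).1 (hs _)
      by_cases h0 : t = 0
      · rwa [h0] at ht
      · exact absurd ht (h ⟨t, h0⟩)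
  have hclopen : IsClopen (D 0) := by
    refine ⟨hDcl 0, ?_⟩
    rw [hD0, isOpen_compl_iff]
    exact isClosed_iUnion_of_finite fun t => hDcl t
  have hK' : IsPreconnected (Subtype.val ⁻¹' K : Set E) := by
    refine Topology.IsInducing.subtypeVal.isPreconnected_image.1 ?_
    rwa [Subtype.image_preimage_coe, Set.inter_eq_right.2 (show K ⊆ E from hKo)]
  obtain ⟨p, rfl⟩ := ha
  have hmem : (⟨s p, hKo _ haK⟩ : E) ∈ D 0 := by
    simp only [D, zero_vadd]
    congr 1
    exact Subtype.ext (hs p)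
  intro x hx
  have := hK'.subset_isClopen hclopen ⟨_, haK, hmem⟩ (show (⟨x, hKo x hx⟩ : E) ∈ _ from hx)
  simp only [D, Set.mem_ofPred_eq, zero_vadd] at this
  exact ⟨_, this⟩

/-- Near x choose `a` in the chamber and `b` with `g +ᵥ b` in the chamber. Flipping the signs in
which `b` differs from `a` puts both in one orthant of the chart, hence in one chamber. As the
translates are disjoint, `g` is that flip, and the flipped coordinates all vanish at x. -/
theorem vadd_eq_self_of_mem_closure (hs : ∀ p, X.proj (s p) = p)
    {x : X.carrier} {g : Z2 n} (hx : x ∈ closure (Set.range s))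
    (hgx : g +ᵥ x ∈ closure (Set.range s)) : g +ᵥ x = x := by
  classical
  obtain ⟨θ, f, -, hxf, hf⟩ := X.locallyStandard x
  have hne : ∀ y ∈ f.source, X.proj y ∈ Cube.openCube n ↔ ∀ i, f y i ≠ 0 := by
    intro y hy
    rw [← X.stabilizer_eq_bot_iff, AddSubgroup.eq_bot_iff_forall]
    constructor
    · intro h i hi
      have := h (θ.symm (Pi.single i 1)) ((mem_stabilizer_iff_of_chart hf hy).2 fun k => by
        by_cases hk : k = i
        · subst hk; exact Or.inr hi
        · left; simp [hk])
      rw [map_eq_zero_iff _ θ.symm.injective] at this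
      exact one_ne_zero (Pi.single_eq_zero_iff.1 this)
    · intro h t ht
      rw [mem_stabilizer_iff_of_chart hf hy] at ht
      rw [← map_eq_zero_iff θ θ.injective]
      ext i
      exact (ht i).resolve_right (h i)
  -- On such a ball, only coordinates vanishing at x can change sign.
  have hev : ∀ᶠ y in nhds (f x), y ∈ f.target ∧ ∀ i, f x i ≠ 0 → 0 < y i * f x i := by
    refine Filter.Eventually.and (f.open_target.mem_nhds (f.map_source hxf)) ?_
    rw [Filter.eventually_all]
    intro i
    by_cases hi : f x i = 0
    · simp [hi]
    · have hc : Continuous fun y : EuclideanSpace ℝ (Fin n) => y i * f x i := by fun_prop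
      filter_upwards [hc.continuousAt.eventually_const_lt (mul_self_pos.2 hi)] with y hy _
      exact hy
  obtain ⟨ε, hε, hball⟩ := Metric.eventually_nhds_iff_ball.1 hev
  have hN : f.source ∩ f ⁻¹' Metric.ball (f x) ε ∈ nhds x :=
    Filter.inter_mem (f.open_source.mem_nhds hxf)
      ((f.continuousAt hxf).preimage_mem_nhds (Metric.ball_mem_nhds _ hε))
  obtain ⟨a, ⟨haf, hab⟩, haC⟩ := mem_closure_iff_nhds.1 hx _ hN
  have hx' : x ∈ closure ((fun y => g +ᵥ y) ⁻¹' Set.range s) := by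
    have := (isOpenMap_vadd g).preimage_closure_eq_closure_preimage
      (continuous_const_vadd g) (Set.range s)
    rw [← this]
    exact hgx
  obtain ⟨b, ⟨hbf, hbb⟩, hbC⟩ := mem_closure_iff_nhds.1 hx' _ hN
  have ha0 := (hne a haf).1 (proj_mem_openCube hs haC)
  have hb0 := (hne b hbf).1 (by
    have := proj_mem_openCube hs hbC
    rwa [X.proj_vadd] at this)
  let w : Z2 n := fun i => if 0 < f a i * f b i then 0 else 1
  have hwx : ∀ i, w i = 0 ∨ f x i = 0 := by
    intro i
    by_cases hi : f x i = 0
    · exact Or.inr hi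
    · left
      have h1 := (hball _ hab).2 i hi
      have h2 := (hball _ hbb).2 i hi
      have : 0 < (f a i * f b i) * (f x i * f x i) := by
        calc 0 < (f a i * f x i) * (f b i * f x i) := mul_pos h1 h2
          _ = _ := by ring
      exact if_pos (pos_of_mul_pos_left this (mul_self_nonneg _))
  have hh : θ.symm w ∈ AddAction.stabilizer (Z2 n) x := by
    rw [mem_stabilizer_iff_of_chart hf hxf, θ.apply_symm_apply]
    exact hwx
  have hfb := hf (θ.symm w) b hbf
  rw [θ.apply_symm_apply] at hfb
  have hsign : ∀ i, 0 < f a i * stdAct w (f b) i := by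
    intro i
    rw [stdAct_apply]
    by_cases hi : 0 < f a i * f b i
    · simp only [w, if_pos hi, neg_one_pow_val_zero, one_mul]
      exact hi
    · simp only [w, if_neg hi, neg_one_pow_val_one]
      have h2 : f a i * f b i ≠ 0 := mul_ne_zero (ha0 i) (hb0 i)
      have h3 : f a i * f b i < 0 := lt_of_le_of_ne (not_lt.1 hi) h2
      linarith
  have hcb : stdAct w (f b) ∈ Metric.ball (f x) ε := by
    have hd : dist (f b) (f x) < ε := hbb
    rwa [Metric.mem_ball, ← stdAct_eq_self_iff.2 hwx, dist_stdAct]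
  -- The segment stays in an open orthant, that is, over the open cube; its preimage is the
  -- connected set joining the two points.
  have hseg : ∀ y ∈ segment ℝ (f a) (stdAct w (f b)), y ∈ f.target ∧ ∀ i, y i ≠ 0 := by
    intro y hy
    refine ⟨(hball y ((convex_ball _ _).segment_subset hab hcb hy)).1, fun i h0 => ?_⟩
    obtain ⟨α, β, hα, hβ, hαβ, rfl⟩ := hy
    simp only [PiLp.add_apply, PiLp.smul_apply, smul_eq_mul] at h0
    have h1 : α * (f a i * f a i) + β * (f a i * stdAct w (f b) i) = 0 := by
      calc _ = f a i * (α * f a i + β * stdAct w (f b) i) := by ring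
        _ = 0 := by rw [h0, mul_zero]
    have h2 := mul_self_pos.2 (ha0 i)
    have h3 := hsign i
    rcases hα.eq_or_lt with rfl | hα
    · have : β = 1 := by linarith
      subst this
      linarith
    · nlinarith [mul_pos hα h2, mul_nonneg hβ h3.le]
  have hK : IsPreconnected (f.symm '' segment ℝ (f a) (stdAct w (f b))) :=
    (convex_segment _ _).isPreconnected.image _
      (f.continuousOn_symm.mono fun y hy => (hseg y hy).1)
  have hKo : ∀ y ∈ f.symm '' segment ℝ (f a) (stdAct w (f b)), X.proj y ∈ Cube.openCube n := by
    rintro _ ⟨y, hy, rfl⟩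
    rw [hne _ (f.map_target (hseg y hy).1), f.right_inv (hseg y hy).1]
    exact (hseg y hy).2
  have hbC' : θ.symm w +ᵥ b ∈ Set.range s := by
    refine subset_range_of_isPreconnected hs hK hKo (a := a)
      ⟨f a, left_mem_segment _ _ _, f.left_inv haf⟩ haC
      ⟨stdAct w (f b), right_mem_segment _ _ _, ?_⟩
    rw [← hfb.2, f.left_inv hfb.1]
  have hg : g - θ.symm w = 0 := by
    refine eq_zero_of_mem_range hs hbC' ?_
    rw [vadd_vadd, sub_add_cancel]
    exact hbC
  rw [sub_eq_zero.1 hg]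
  exact hh

end Chamber

variable (X)

/-- π maps the compact closed chamber bijectively onto the cube: injectively because two of its
points in one orbit coincide, onto because the image is closed and contains the dense open cube. The
inverse is the section. -/
theorem exists_section : ∃ s : C(Cube n, X.carrier), ∀ p, X.proj (s p) = p := by
  obtain ⟨s, hs⟩ := X.exists_section_openCube
  have hcont : Continuous fun x : closure (Set.range s) => X.proj x :=
    X.isQuotientMap_proj.continuous.comp continuous_subtype_val
  have hinj : Function.Injective fun x : closure (Set.range s) => X.proj x := by
    rintro ⟨x, hx⟩ ⟨y, hy⟩ hxy
    obtain ⟨g, rfl⟩ := (X.proj_eq_iff x y).1 hxy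
    exact Subtype.ext (vadd_eq_self_of_mem_closure hs hx hy).symm
  have : CompactSpace (closure (Set.range s)) :=
    isCompact_iff_compactSpace.1 isClosed_closure.isCompact
  have hsurj : Function.Surjective fun x : closure (Set.range s) => X.proj x := by
    rw [← Set.range_eq_univ, ← (isCompact_range hcont).isClosed.closure_eq, Set.eq_univ_iff_forall]
    intro p
    have hp : p ∈ closure (Cube.openCube n) := by
      rw [Cube.closure_openCube]; trivial
    refine closure_mono (fun q hq => ?_) hp
    exact ⟨⟨s ⟨q, hq⟩, subset_closure ⟨_, rfl⟩⟩, hs _⟩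
  let e : closure (Set.range s) ≃ₜ Cube n :=
    Continuous.homeoOfEquivCompactToT2 (f := Equiv.ofBijective _ ⟨hinj, hsurj⟩) hcont
  refine ⟨⟨fun p => (e.symm p : X.carrier), continuous_subtype_val.comp e.symm.continuous⟩, ?_⟩
  intro p
  exact e.apply_symm_apply p

variable {X} {Y : SmallCover.{u} n}

/-- With sections `s` and `r`, the map `t +ᵥ s p ↦ φ t +ᵥ r p` is well defined and injective exactly
because isotropy groups correspond under `φ`. -/
theorem djEquiv_of_stabilizer (φ : Z2 n ≃+ Z2 n)
    (h : ∀ (x : X.carrier) (y : Y.carrier) (t : Z2 n), X.proj x = Y.proj y →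
      (t +ᵥ x = x ↔ φ t +ᵥ y = y)) : X.DJEquiv Y := by
  obtain ⟨s, hs⟩ := X.exists_section
  obtain ⟨r, hr⟩ := Y.exists_section
  have heq : ∀ (t t' : Z2 n) (p : Cube n),
      t +ᵥ s p = t' +ᵥ s p ↔ φ t +ᵥ r p = φ t' +ᵥ r p := by
    intro t t' p
    have := h (s p) (r p) (-t' + t) (by rw [hs, hr])
    rw [map_add, map_neg, add_vadd, add_vadd, neg_vadd_eq_iff, neg_vadd_eq_iff] at this
    exact this
  have hex : ∀ x : X.carrier, ∃ t : Z2 n, t +ᵥ s (X.proj x) = x := fun x =>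
    (X.proj_eq_iff _ _).1 (hs _)
  choose τ hτ using hex
  let f : X.carrier → Y.carrier := fun x => φ (τ x) +ᵥ r (X.proj x)
  have hf : ∀ t p, f (t +ᵥ s p) = φ t +ᵥ r p := by
    intro t p
    have hp : X.proj (t +ᵥ s p) = p := by rw [X.proj_vadd, hs]
    have h1 := hτ (t +ᵥ s p)
    simp only [f]
    rw [hp] at h1 ⊢
    exact (heq _ _ p).1 h1
  have hpf : ∀ x, Y.proj (f x) = X.proj x := fun x => by rw [Y.proj_vadd, hr]
  have hcont : Continuous f := by
    -- X is a quotient of ℤ₂ⁿ × Iⁿ, so continuity is checked on each sheet.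
    let a : Z2 n × Cube n → X.carrier := fun q => q.1 +ᵥ s q.2
    have ha : Continuous a := continuous_prod_of_discrete_left.2 fun t =>
      (continuous_const_vadd t).comp s.continuous
    have hsurj : Function.Surjective a := fun x => ⟨(τ x, X.proj x), hτ x⟩
    have hq : Topology.IsQuotientMap a := ha.isClosedMap.isQuotientMap ha hsurj
    rw [hq.continuous_iff, continuous_prod_of_discrete_left]
    intro t
    have : (fun p => (f ∘ a) (t, p)) = fun p => φ t +ᵥ r p := funext fun p => hf t p
    rw [this]
    exact (continuous_const_vadd _).comp r.continuous
  have hinj : Function.Injective f := by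
    intro x x' hxx
    have hp : X.proj x = X.proj x' := by rw [← hpf, ← hpf, hxx]
    rw [← hτ x, ← hτ x', hp, heq]
    simpa only [f, hp] using hxx
  have hsurj : Function.Surjective f := by
    intro y
    obtain ⟨t, ht⟩ := (Y.proj_eq_iff _ _).1 (hr (Y.proj y))
    refine ⟨φ.symm t +ᵥ s (Y.proj y), ?_⟩
    rw [hf, φ.apply_symm_apply, ht]
  refine ⟨φ, Continuous.homeoOfEquivCompactToT2 (f := Equiv.ofBijective f ⟨hinj, hsurj⟩) hcont,
    fun t x => ?_, hpf⟩
  change f (t +ᵥ x) = φ t +ᵥ f x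
  rw [← hτ x, vadd_vadd, hf, hf, map_add, add_vadd]

variable {Λ Λ' : Matrix (Fin n) (Fin n ⊕ Fin n) (ZMod 2)}

theorem djEquiv_of_inv_mul_eq (hΛ : X.IsCharMatrix Λ) (hΛ' : Y.IsCharMatrix Λ')
    (h : Λ.toCols₁⁻¹ * Λ.toCols₂ = Λ'.toCols₁⁻¹ * Λ'.toCols₂) : X.DJEquiv Y := by
  have hA := hΛ.isUnit_toCols₁
  have hA' := hΛ'.isUnit_toCols₁
  set P := Λ'.toCols₁ * Λ.toCols₁⁻¹ with hP
  have hPu : IsUnit P := by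
    rw [Matrix.isUnit_iff_isUnit_det, Matrix.det_mul]
    exact hA'.mul (Matrix.isUnit_nonsing_inv_det _ hA)
  have hmul : Λ' = P * Λ := by
    rw [hΛ'.eq_mul, ← h]
    conv_rhs => rw [hΛ.eq_mul]
    rw [hP, Matrix.mul_assoc, Matrix.nonsing_inv_mul_cancel_left _ _ hA]
  have hbij : Function.Bijective P.mulVec :=
    ⟨Matrix.mulVec_injective_of_isUnit hPu, Matrix.mulVec_surjective_iff_isUnit.2 hPu⟩
  let φ : Z2 n ≃+ Z2 n := AddEquiv.ofBijective
    (⟨⟨P.mulVec, Matrix.mulVec_zero P⟩, Matrix.mulVec_add P⟩ : Z2 n →+ Z2 n) hbij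
  refine djEquiv_of_stabilizer φ fun x y t hxy => ?_
  rw [← AddAction.mem_stabilizer_iff, ← AddAction.mem_stabilizer_iff, hΛ.mem_stabilizer_iff,
    hΛ'.mem_stabilizer_iff, hmul, vertexMatrix_mul, ← hxy]
  have hφ : φ t = P.mulVec t := rfl
  simp only [hφ, ← Matrix.mulVec_mulVec, hbij.1.eq_iff]

end SmallCover

/-! ### Real Bott manifolds: deck group and quotient -/

/-- The sign `±1` attached to an element of `ℤ₂`. -/
def signZ2 (a : ZMod 2) : ℤ := (-1) ^ a.val

theorem signZ2_zero : signZ2 0 = 1 := rfl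

theorem signZ2_one : signZ2 1 = -1 := rfl

theorem signZ2_add (a b : ZMod 2) : signZ2 (a + b) = signZ2 a * signZ2 b := by
  revert a b; decide

theorem signZ2_mul_self (a : ZMod 2) : signZ2 a * signZ2 a = 1 := by
  revert a; decide

theorem intCast_signZ2_mul (a : ZMod 2) (m : ℤ) : ((signZ2 a * m : ℤ) : ZMod 2) = m := by
  have : ((signZ2 a : ℤ) : ZMod 2) = 1 := by revert a; decide
  rw [Int.cast_mul, this, one_mul]

theorem stdAct_apply_eq_signZ2 {n : ℕ} (t : Z2 n) (y : EuclideanSpace ℝ (Fin n)) (i : Fin n) :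
    stdAct t y i = signZ2 (t i) * y i := by
  rw [stdAct_apply, signZ2]
  push_cast
  rfl

theorem stdAct_zero {n : ℕ} (y : EuclideanSpace ℝ (Fin n)) : stdAct 0 y = y := by
  ext i
  simp [stdAct_apply]

theorem stdAct_add {n : ℕ} (s t : Z2 n) (y : EuclideanSpace ℝ (Fin n)) :
    stdAct (s + t) y = stdAct s (stdAct t y) := by
  ext i
  rw [stdAct_apply_eq_signZ2, stdAct_apply_eq_signZ2, stdAct_apply_eq_signZ2, Pi.add_apply,
    signZ2_add]
  push_cast
  ring

theorem contDiff_stdAct {n : ℕ} (t : Z2 n) {m : WithTop ℕ∞} : ContDiff ℝ m (stdAct t) := by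
  rw [contDiff_euclidean]
  intro i
  simp only [stdAct_apply]
  fun_prop

/-- In characteristic 2 a column of B is the unit column plus that of 1 + B. The second summand is a
`deckSign`, which links vertex matrices to deck transformations. -/
theorem vertexMatrix_fromCols_one_mulVec {n : ℕ} (B : Matrix (Fin n) (Fin n) (ZMod 2))
    (S : Set (Fin n)) [DecidablePred (· ∈ S)] (w : Z2 n) :
    (vertexMatrix (Matrix.fromCols 1 B) S).mulVec w =
      w + (1 + B).mulVec fun j => if j ∈ S then w j else 0 := by
  ext i
  have h1 : w i = ∑ j, (1 : Matrix (Fin n) (Fin n) (ZMod 2)) i j * w j := by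
    conv_lhs => rw [← Matrix.one_mulVec w]
    rfl
  simp only [Matrix.mulVec, dotProduct, Pi.add_apply]
  rw [h1, ← Finset.sum_add_distrib]
  refine Finset.sum_congr rfl fun j _ => ?_
  by_cases hj : j ∈ S
  · simp only [vertexMatrix, Cube.vertexFacet, hj, if_true, Matrix.submatrix_apply, id,
      Matrix.fromCols_apply_inr, Matrix.add_apply, add_mul]
    rw [← add_assoc, CharTwo.add_self_eq_zero, zero_add]
  · simp [vertexMatrix, Cube.vertexFacet, hj]

namespace RealBott

variable {n : ℕ} (B : Matrix (Fin n) (Fin n) (ZMod 2))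

/-- The sign changes in the linear part of the deck transformation with translation part `2k`. -/
def deckSign (k : Fin n → ℤ) : Z2 n := (1 + B).mulVec fun j => (k j : ZMod 2)

/-- The deck transformations: sign changes followed by translations by even vectors. -/
noncomputable def deckAct (k : Fin n → ℤ) (x : EuclideanSpace ℝ (Fin n)) :
    EuclideanSpace ℝ (Fin n) :=
  WithLp.toLp 2 fun i => signZ2 (deckSign B k i) * x i + 2 * k i

variable {B}

theorem deckAct_apply (k : Fin n → ℤ) (x : EuclideanSpace ℝ (Fin n)) (i : Fin n) :
    deckAct B k x i = signZ2 (deckSign B k i) * x i + 2 * k i := rfl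

theorem deckSign_congr {k l : Fin n → ℤ} (h : ∀ j, (k j : ZMod 2) = l j) :
    deckSign B k = deckSign B l := by
  unfold deckSign
  congr 1
  exact funext h

theorem deckSign_signZ2_mul (t : Z2 n) (k : Fin n → ℤ) :
    deckSign B (fun j => signZ2 (t j) * k j) = deckSign B k :=
  deckSign_congr fun _ => intCast_signZ2_mul _ _

theorem deckSign_zero : deckSign B 0 = 0 := by
  have : (fun j : Fin n => (((0 : Fin n → ℤ) j : ℤ) : ZMod 2)) = 0 := by
    ext j; simp
  rw [deckSign, this, Matrix.mulVec_zero]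

theorem deckSign_add (k l : Fin n → ℤ) : deckSign B (k + l) = deckSign B k + deckSign B l := by
  rw [deckSign, deckSign, deckSign, ← Matrix.mulVec_add]
  congr 1
  ext j
  simp

theorem deckAct_zero (x : EuclideanSpace ℝ (Fin n)) : deckAct B 0 x = x := by
  ext i
  simp [deckAct_apply, deckSign_zero, signZ2_zero]

/-- Signs are invisible mod 2, so twisting `l` leaves its `deckSign` unchanged and the family is
closed under composition. -/
theorem deckAct_deckAct (k l : Fin n → ℤ) (x : EuclideanSpace ℝ (Fin n)) :
    deckAct B k (deckAct B l x) =
      deckAct B (k + fun j => signZ2 (deckSign B k j) * l j) x := by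
  ext i
  rw [deckAct_apply, deckAct_apply, deckAct_apply, deckSign_add, deckSign_signZ2_mul, Pi.add_apply,
    signZ2_add, Pi.add_apply]
  push_cast
  ring

theorem exists_deckAct_symm (k : Fin n → ℤ) (x : EuclideanSpace ℝ (Fin n)) :
    ∃ l, deckAct B l (deckAct B k x) = x := by
  -- The inverse of x ↦ εx + 2k translates by -2εk; adding 1 in the exponent supplies the minus
  -- sign.
  refine ⟨fun j => signZ2 (deckSign B k j + 1) * k j, ?_⟩
  rw [deckAct_deckAct]
  convert! deckAct_zero x
  have h := deckSign_signZ2_mul (B := B) (deckSign B k + 1) k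
  simp only [Pi.add_apply, Pi.one_apply] at h
  ext j
  rw [h]
  simp [signZ2_add, signZ2_one]

theorem stdAct_deckAct (t : Z2 n) (k : Fin n → ℤ) (x : EuclideanSpace ℝ (Fin n)) :
    stdAct t (deckAct B k x) = deckAct B (fun j => signZ2 (t j) * k j) (stdAct t x) := by
  ext i
  rw [stdAct_apply_eq_signZ2, deckAct_apply, deckAct_apply, deckSign_signZ2_mul,
    stdAct_apply_eq_signZ2]
  push_cast
  ring

theorem contDiff_deckAct (k : Fin n → ℤ) {m : WithTop ℕ∞} : ContDiff ℝ m (deckAct B k) := by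
  rw [contDiff_euclidean]
  intro i
  simp only [deckAct_apply]
  fun_prop

variable (B)

/-- The orbit relation of the group of deck transformations. -/
def deckSetoid : Setoid (EuclideanSpace ℝ (Fin n)) where
  r x y := ∃ k, deckAct B k x = y
  iseqv :=
    { refl := fun x => ⟨0, deckAct_zero x⟩
      symm := by
        rintro x _ ⟨k, rfl⟩
        exact exists_deckAct_symm k x
      trans := by
        rintro x _ _ ⟨k, rfl⟩ ⟨l, rfl⟩
        exact ⟨_, (deckAct_deckAct l k x).symm⟩ }

end RealBott

/-- The real Bott manifold of a matrix `B`: the quotient of `ℝⁿ` by the deck transformations. -/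
def RealBott {n : ℕ} (B : Matrix (Fin n) (Fin n) (ZMod 2)) : Type u :=
  ULift.{u} (Quotient (RealBott.deckSetoid B))

namespace RealBott

variable {n : ℕ} {B : Matrix (Fin n) (Fin n) (ZMod 2)}

instance : TopologicalSpace (RealBott.{u} B) :=
  inferInstanceAs (TopologicalSpace (ULift.{u} (Quotient (deckSetoid B))))

variable (B) in
/-- The projection of `ℝⁿ` onto the real Bott manifold. -/
def mk (x : EuclideanSpace ℝ (Fin n)) : RealBott.{u} B := ULift.up (Quotient.mk (deckSetoid B) x)

theorem mk_surjective : Function.Surjective (mk.{u} B) := by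
  rintro ⟨⟨x⟩⟩
  exact ⟨x, rfl⟩

theorem mk_eq_mk_iff {x y : EuclideanSpace ℝ (Fin n)} :
    mk.{u} B x = mk B y ↔ ∃ k, deckAct B k x = y :=
  ULift.up_inj.trans (Quotient.eq (r := deckSetoid B))

theorem mk_deckAct (k : Fin n → ℤ) (x : EuclideanSpace ℝ (Fin n)) :
    mk.{u} B (deckAct B k x) = mk B x := (mk_eq_mk_iff.2 ⟨k, rfl⟩).symm

theorem isQuotientMap_mk : Topology.IsQuotientMap (mk.{u} B) :=
  Homeomorph.ulift.symm.isQuotientMap.comp isQuotientMap_quotient_mk'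

theorem isOpenMap_mk : IsOpenMap (mk.{u} B) := by
  intro U hU
  rw [← isQuotientMap_mk.isOpen_preimage]
  have : mk.{u} B ⁻¹' (mk B '' U) = ⋃ k, deckAct B k ⁻¹' U := by
    ext x
    simp only [Set.mem_preimage, Set.mem_image, Set.mem_iUnion]
    constructor
    · rintro ⟨y, hy, h⟩
      obtain ⟨k, rfl⟩ := mk_eq_mk_iff.1 h.symm
      exact ⟨k, hy⟩
    · rintro ⟨k, hk⟩
      exact ⟨_, hk, mk_deckAct k x⟩
  rw [this]
  exact isOpen_iUnion fun k => hU.preimage (contDiff_deckAct (m := 0) k).continuous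

noncomputable instance : AddAction (Z2 n) (RealBott.{u} B) where
  vadd t x := ULift.up (Quotient.map (sa := deckSetoid B) (sb := deckSetoid B) (stdAct t)
    (by rintro x _ ⟨k, rfl⟩; exact ⟨_, (stdAct_deckAct t k x).symm⟩) x.down)
  zero_vadd := by
    rintro ⟨⟨x⟩⟩
    exact congrArg (mk B) (stdAct_zero x)
  add_vadd := by
    rintro s t ⟨⟨x⟩⟩
    exact congrArg (mk B) (stdAct_add s t x)

theorem vadd_mk (t : Z2 n) (x : EuclideanSpace ℝ (Fin n)) :
    t +ᵥ mk.{u} B x = mk B (stdAct t x) := rfl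

/-- The folding map of the line onto the unit interval, with folds at the integers. -/
noncomputable def fold (a : ℝ) : unitInterval :=
  ⟨(1 - Real.cos (Real.pi * a)) / 2, by linarith [Real.cos_le_one (Real.pi * a)],
    by linarith [Real.neg_one_le_cos (Real.pi * a)]⟩

theorem continuous_fold : Continuous fold := by
  unfold fold
  fun_prop

theorem fold_eq_fold_iff {a b : ℝ} :
    fold a = fold b ↔ ∃ (ε : ZMod 2) (k : ℤ), b = signZ2 ε * a + 2 * k := by
  have h : fold a = fold b ↔ Real.cos (Real.pi * a) = Real.cos (Real.pi * b) := by
    refine Subtype.ext_iff.trans ?_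
    simp only [fold]
    constructor <;> intro h <;> linarith
  rw [h, Real.cos_eq_cos_iff]
  have hπ := Real.pi_ne_zero
  constructor
  · rintro ⟨k, h | h⟩
    · refine ⟨0, k, mul_left_cancel₀ hπ ?_⟩
      rw [h, signZ2_zero]; push_cast; ring
    · refine ⟨1, k, mul_left_cancel₀ hπ ?_⟩
      rw [h, signZ2_one]; push_cast; ring
  · rintro ⟨ε, k, rfl⟩
    refine ⟨k, ?_⟩
    rcases ZMod.eq_zero_or_eq_one ε with rfl | rfl
    · left; rw [signZ2_zero]; push_cast; ring
    · right; rw [signZ2_one]; push_cast; ring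

theorem fold_zero : fold 0 = 0 := by
  ext; simp [fold]

theorem fold_one : fold 1 = 1 := by
  ext; simp [fold]

theorem exists_fold_eq (p : unitInterval) : ∃ a ∈ Set.Icc (0 : ℝ) 1, fold a = p := by
  have hπ := Real.pi_pos
  refine ⟨Real.arccos (1 - 2 * p) / Real.pi, ⟨?_, ?_⟩, ?_⟩
  · exact div_nonneg (Real.arccos_nonneg _) hπ.le
  · rw [div_le_one hπ]; exact Real.arccos_le_pi _
  · ext
    simp only [fold]
    rw [mul_div_cancel₀ _ hπ.ne', Real.cos_arccos (by linarith [p.2.2]) (by linarith [p.2.1])]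
    ring

theorem exists_of_fold_eq_zero {a : ℝ} (h : fold a = 0) : ∃ m : ℤ, a = 2 * m := by
  rw [← fold_zero, eq_comm, fold_eq_fold_iff] at h
  obtain ⟨ε, k, h⟩ := h
  exact ⟨k, by simpa using h⟩

theorem exists_of_fold_eq_one {a : ℝ} (h : fold a = 1) : ∃ m : ℤ, a = 2 * m + 1 := by
  rw [← fold_one, eq_comm, fold_eq_fold_iff] at h
  obtain ⟨ε, k, h⟩ := h
  rcases ZMod.eq_zero_or_eq_one ε with rfl | rfl
  · exact ⟨k, by rw [h, signZ2_zero]; push_cast; ring⟩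
  · exact ⟨k - 1, by rw [h, signZ2_one]; push_cast; ring⟩

theorem fold_intCast (m : ℤ) : fold m = 0 ∨ fold m = 1 := by
  rcases Int.even_or_odd' m with ⟨k, rfl | rfl⟩
  · left
    rw [← fold_zero, eq_comm, fold_eq_fold_iff]
    exact ⟨0, k, by push_cast; ring⟩
  · right
    rw [← fold_one, eq_comm, fold_eq_fold_iff]
    exact ⟨0, k, by rw [signZ2_zero]; push_cast; ring⟩

/-- The projection of the real Bott manifold to the cube. -/
noncomputable def proj (x : RealBott.{u} B) : Cube n :=
  Quotient.lift (s := deckSetoid B) (fun (x : EuclideanSpace ℝ (Fin n)) i => fold (x i))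
    (by
      rintro x _ ⟨k, rfl⟩
      ext1 i
      exact fold_eq_fold_iff.2 ⟨_, _, deckAct_apply k x i⟩) x.down

theorem proj_mk (x : EuclideanSpace ℝ (Fin n)) (i : Fin n) : proj (mk.{u} B x) i = fold (x i) := rfl

theorem continuous_proj : Continuous (proj.{u} (B := B)) := by
  rw [isQuotientMap_mk.continuous_iff]
  refine continuous_pi fun i => continuous_fold.comp ?_
  fun_prop

theorem proj_surjective : Function.Surjective (proj.{u} (B := B)) := by
  intro p
  choose a _ ha using fun i => exists_fold_eq (p i)
  exact ⟨mk B (WithLp.toLp 2 a), funext ha⟩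

theorem proj_eq_iff (x y : RealBott.{u} B) : proj x = proj y ↔ ∃ t : Z2 n, t +ᵥ x = y := by
  obtain ⟨x, rfl⟩ := mk_surjective x
  obtain ⟨y, rfl⟩ := mk_surjective y
  constructor
  · intro h
    choose ε k h using fun i => fold_eq_fold_iff.1 (congrFun h i)
    -- The summand `deckSign B k` cancels the linear part of the deck transformation used to
    -- translate by 2k.
    refine ⟨deckSign B k + ε, ?_⟩
    rw [vadd_mk, mk_eq_mk_iff]
    refine ⟨k, ?_⟩
    ext i
    rw [deckAct_apply, stdAct_apply_eq_signZ2, Pi.add_apply, signZ2_add, h i, Int.cast_mul,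
      ← mul_assoc, ← mul_assoc, ← Int.cast_mul, signZ2_mul_self, Int.cast_one, one_mul]
  · rintro ⟨t, h⟩
    rw [vadd_mk] at h
    rw [← h]
    ext1 i
    rw [proj_mk, proj_mk, fold_eq_fold_iff]
    exact ⟨t i, 0, by rw [stdAct_apply_eq_signZ2]; simp⟩

/-! ### Real Bott manifolds: charts around vertices -/

open scoped Classical in
/-- The vertex of the unit cube whose coordinates equal to `1` are those in `S`. -/
noncomputable def vertex (S : Set (Fin n)) : EuclideanSpace ℝ (Fin n) :=
  WithLp.toLp 2 fun j => if j ∈ S then 1 else 0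

variable (n) in
/-- The cube `(-1, 1)ⁿ`. -/
def box : Set (EuclideanSpace ℝ (Fin n)) := {y | ∀ i, |y i| < 1}

theorem isOpen_box : IsOpen (box n) := by
  have : box n = ⋂ i, {y : EuclideanSpace ℝ (Fin n) | |y i| < 1} := by
    ext y; simp [box]
  rw [this]
  exact isOpen_iInter_of_finite fun i => isOpen_lt (by fun_prop) continuous_const

theorem stdAct_mem_box {t : Z2 n} {y : EuclideanSpace ℝ (Fin n)} (hy : y ∈ box n) :
    stdAct t y ∈ box n := by
  intro i
  rw [stdAct_apply, abs_mul, abs_pow, abs_neg, abs_one, one_pow, one_mul]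
  exact hy i

variable (B) in
/-- The parametrization of the real Bott manifold around the points over a vertex. -/
noncomputable def param (S : Set (Fin n)) (y : EuclideanSpace ℝ (Fin n)) : RealBott.{u} B :=
  mk B (vertex S + y)

theorem continuous_param (S : Set (Fin n)) : Continuous (param.{u} B S) :=
  isQuotientMap_mk.continuous.comp (continuous_const_add _)

theorem isOpenMap_param (S : Set (Fin n)) : IsOpenMap (param.{u} B S) :=
  isOpenMap_mk.comp (isOpenMap_add_left _)

theorem exists_param_eq (x : RealBott.{u} B) :
    ∃ y ∈ box n, proj (param B {i | proj x i ≠ 0} y) = proj x := by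
  classical
  choose a ha hfa using fun i => exists_fold_eq (proj x i)
  have ha0 : ∀ i, proj x i ≠ 0 → a i ≠ 0 := by
    intro i hi h
    rw [← hfa, h, fold_zero] at hi
    exact hi rfl
  -- Nonzero coordinates are measured from 1, which moves (0, 1] into (-1, 0].
  refine ⟨WithLp.toLp 2 fun i => if proj x i = 0 then 0 else a i - 1, ?_, ?_⟩
  · intro i
    by_cases hi : proj x i = 0
    · simp [hi]
    · simp only [hi, if_false]
      rw [abs_lt]
      have h0 : 0 < a i := lt_of_le_of_ne (ha i).1 (ha0 i hi).symm
      constructor <;> linarith [(ha i).2]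
  · ext1 i
    by_cases hi : proj x i = 0
    · simp [param, proj_mk, vertex, hi, fold_zero]
    · simp [param, proj_mk, vertex, hi, hfa]

variable [hB : Fact (B ∈ principalMinorsOne n)]

variable (B) in
theorem isUnit_vertexMatrix (S : Set (Fin n)) :
    IsUnit (vertexMatrix (Matrix.fromCols 1 B) S) :=
  mem_principalMinorsOne_iff.1 hB.out S

/-- If `deckAct B k` relates two points of the box, size estimates force each `k i` to be 0 where
the sign is + and the vertex coordinate where it is -. So `k` reduces to `deckSign B k` restricted
to `S`, which puts `deckSign B k` in the kernel of the vertex matrix. This is where membership in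
M(n) makes the deck group act freely on the box. -/
theorem injOn_param (S : Set (Fin n)) : Set.InjOn (param.{u} B S) (box n) := by
  classical
  intro y hy y' hy' h
  obtain ⟨k, hk⟩ := mk_eq_mk_iff.1 h
  have hcoord : ∀ i, (k i : ℤ) = if i ∈ S then (if deckSign B k i = 0 then 0 else 1) else 0 := by
    intro i
    have h1 := congrArg (fun z : EuclideanSpace ℝ (Fin n) => z i) hk
    simp only [deckAct_apply, PiLp.add_apply, vertex] at h1
    have h2 := abs_lt.1 (hy i)
    have h3 := abs_lt.1 (hy' i)
    have aux : ∀ m : ℤ, (-1 : ℝ) < m → (m : ℝ) < 1 → m = 0 := by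
      intro m h h'
      have h4 : (-1 : ℤ) < m := by exact_mod_cast h
      have h5 : m < (1 : ℤ) := by exact_mod_cast h'
      omega
    rcases ZMod.eq_zero_or_eq_one (deckSign B k i) with h0 | h0
    · rw [h0, signZ2_zero] at h1
      push_cast at h1
      simp only [h0, if_true, ite_self]
      exact aux _ (by linarith) (by linarith)
    · rw [h0, signZ2_one] at h1
      push_cast at h1
      simp only [h0, one_ne_zero, if_false]
      by_cases hi : i ∈ S
      · simp only [hi, if_true] at h1 ⊢
        have := aux (k i - 1) (by push_cast; linarith) (by push_cast; linarith)
        omega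
      · simp only [hi, if_false] at h1 ⊢
        exact aux _ (by linarith) (by linarith)
  have hz : (vertexMatrix (Matrix.fromCols 1 B) S).mulVec (deckSign B k) = 0 := by
    rw [vertexMatrix_fromCols_one_mulVec]
    have : (fun j => if j ∈ S then deckSign B k j else 0) = fun j => (k j : ZMod 2) := by
      ext j
      rw [hcoord j]
      rcases ZMod.eq_zero_or_eq_one (deckSign B k j) with h0 | h0 <;> by_cases hj : j ∈ S <;>
        simp [h0, hj]
    rw [this]
    change deckSign B k + deckSign B k = 0
    ext j
    exact CharTwo.add_self_eq_zero _
  have hs : deckSign B k = 0 :=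
    Matrix.mulVec_injective_of_isUnit (isUnit_vertexMatrix B S)
      (hz.trans (Matrix.mulVec_zero _).symm)
  have hk0 : k = 0 := by
    ext i
    rw [hcoord i, hs]
    simp
  rw [hk0, deckAct_zero] at hk
  exact add_left_cancel hk

variable (B) in
/-- The chart of the real Bott manifold around the points over a vertex. -/
noncomputable def chart (S : Set (Fin n)) :
    OpenPartialHomeomorph (RealBott.{u} B) (EuclideanSpace ℝ (Fin n)) :=
  (OpenPartialHomeomorph.ofContinuousOpen ((injOn_param S).toPartialEquiv (param B S) (box n))
    (continuous_param S).continuousOn (isOpenMap_param S) isOpen_box).symm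

theorem chart_param {S : Set (Fin n)} {y : EuclideanSpace ℝ (Fin n)} (hy : y ∈ box n) :
    chart.{u} B S (param B S y) = y :=
  (chart B S).right_inv hy

theorem param_mem_source {S : Set (Fin n)} {y : EuclideanSpace ℝ (Fin n)} (hy : y ∈ box n) :
    param B S y ∈ (chart.{u} B S).source := ⟨y, hy, rfl⟩

theorem mulVec_bijective (S : Set (Fin n)) :
    Function.Bijective (vertexMatrix (Matrix.fromCols 1 B) S).mulVec :=
  ⟨Matrix.mulVec_injective_of_isUnit (isUnit_vertexMatrix B S),
    Matrix.mulVec_surjective_iff_isUnit.2 (isUnit_vertexMatrix B S)⟩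

variable (B) in
/-- The automorphism of `ℤ₂ⁿ` that makes a chart around a vertex equivariant. -/
noncomputable def chartAut (S : Set (Fin n)) : Z2 n ≃+ Z2 n :=
  (AddEquiv.ofBijective
    (⟨⟨(vertexMatrix (Matrix.fromCols 1 B) S).mulVec, Matrix.mulVec_zero _⟩,
      Matrix.mulVec_add _⟩ : Z2 n →+ Z2 n) (mulVec_bijective S)).symm

theorem vadd_param (S : Set (Fin n)) (t : Z2 n) (y : EuclideanSpace ℝ (Fin n)) :
    t +ᵥ param.{u} B S y = param B S (stdAct (chartAut B S t) y) := by
  classical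
  obtain ⟨w, rfl⟩ := (chartAut B S).symm.surjective t
  rw [AddEquiv.apply_symm_apply]
  have hw : (chartAut B S).symm w = (vertexMatrix (Matrix.fromCols 1 B) S).mulVec w := rfl
  rw [hw, vertexMatrix_fromCols_one_mulVec, param, param, vadd_mk, mk_eq_mk_iff]
  -- Reflecting sends vertex coordinates 1 to -1; translation by 2 on these coordinates brings them
  -- back, and its signs cancel the `1 + B` term.
  refine ⟨fun j => if j ∈ S then (if w j = 0 then 0 else 1) else 0, ?_⟩
  have hs : deckSign B (fun j => if j ∈ S then (if w j = 0 then 0 else 1) else 0) =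
      (1 + B).mulVec fun j => if j ∈ S then w j else 0 := by
    unfold deckSign
    congr 1
    ext j
    rcases ZMod.eq_zero_or_eq_one (w j) with h0 | h0 <;> by_cases hj : j ∈ S <;> simp [h0, hj]
  ext i
  rw [deckAct_apply, hs, stdAct_apply_eq_signZ2, PiLp.add_apply, PiLp.add_apply,
    stdAct_apply_eq_signZ2, Pi.add_apply, signZ2_add]
  generalize ((1 + B).mulVec fun j => if j ∈ S then w j else 0) i = c
  have hc : ((signZ2 c : ℤ) : ℝ) * signZ2 c = 1 := by
    rw [← Int.cast_mul, signZ2_mul_self, Int.cast_one]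
  have e : (signZ2 c : ℝ) * (((signZ2 (w i) * signZ2 c : ℤ) : ℝ) * (vertex S i + y i)) =
      signZ2 (w i) * (vertex S i + y i) := by
    push_cast
    linear_combination (signZ2 (w i) : ℝ) * (vertex S i + y i) * hc
  rw [e]
  rcases ZMod.eq_zero_or_eq_one (w i) with h0 | h0 <;> by_cases hi : i ∈ S <;>
    simp only [h0, hi, vertex, signZ2_zero, signZ2_one, if_true, if_false, one_ne_zero] <;>
    push_cast <;> ring

theorem chart_equivariant (S : Set (Fin n)) (t : Z2 n) :
    ∀ x ∈ (chart.{u} B S).source, t +ᵥ x ∈ (chart B S).source ∧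
      chart B S (t +ᵥ x) = stdAct (chartAut B S t) (chart B S x) := by
  rintro _ ⟨y, hy, rfl⟩
  have h := stdAct_mem_box (t := chartAut B S t) hy
  change t +ᵥ param B S y ∈ _ ∧ chart B S (t +ᵥ param B S y) = stdAct _ (chart B S (param B S y))
  rw [vadd_param, chart_param h, chart_param hy]
  exact ⟨param_mem_source h, rfl⟩

theorem mem_chart_source {x y : RealBott.{u} B} (h : proj y = proj x) :
    y ∈ (chart B {i | proj x i ≠ 0}).source := by
  obtain ⟨z, hz, hzx⟩ := exists_param_eq x
  obtain ⟨t, rfl⟩ := (proj_eq_iff _ _).1 (hzx.trans h.symm)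
  exact (chart_equivariant _ t _ (param_mem_source hz)).1

noncomputable instance : ChartedSpace (EuclideanSpace ℝ (Fin n)) (RealBott.{u} B) where
  atlas := Set.range (chart B)
  chartAt x := chart B {i | proj x i ≠ 0}
  mem_chart_source _ := mem_chart_source rfl
  chart_mem_atlas _ := ⟨_, rfl⟩

instance : IsManifold (𝓡 n) ∞ (RealBott.{u} B) := by
  refine isManifold_of_contDiffOn _ _ _ ?_
  rintro _ _ ⟨S, rfl⟩ ⟨S', rfl⟩
  simp only [modelWithCornersSelf_coe, modelWithCornersSelf_coe_symm, Function.id_comp,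
    Function.comp_id, Set.range_id, Set.inter_univ, Set.preimage_id]
  rintro y ⟨hy, hy'⟩
  have hy : y ∈ box n := hy
  have hy' : param B S y ∈ (chart B S').source := hy'
  obtain ⟨z, hz, hzy⟩ := hy'
  obtain ⟨k, hk⟩ := mk_eq_mk_iff.1 (show mk B (vertex S + y) = mk B (vertex S' + z) from hzy.symm)
  -- Near `y` the transition map is one fixed deck transformation between recentred boxes, hence
  -- affine.
  let g : EuclideanSpace ℝ (Fin n) → EuclideanSpace ℝ (Fin n) :=
    fun y => deckAct B k (vertex S + y) - vertex S'
  have hg : ContDiff ℝ ∞ g :=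
    ((contDiff_deckAct k).comp (contDiff_const.add contDiff_id)).sub contDiff_const
  have hgy : g y = z := by simp only [g, hk, add_sub_cancel_left]
  refine ContDiffAt.contDiffWithinAt (hg.contDiffAt.congr_of_eventuallyEq ?_)
  have hev : ∀ᶠ y' in nhds y, g y' ∈ box n :=
    hg.continuous.continuousAt.preimage_mem_nhds (isOpen_box.mem_nhds (hgy ▸ hz))
  filter_upwards [hev] with y' h'
  change chart B S' (param B S y') = g y'
  have : param.{u} B S y' = param B S' (g y') := by
    simp only [param, g, add_sub_cancel, mk_deckAct]
  rw [this, chart_param h']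

theorem chart_mem_maximalAtlas (S : Set (Fin n)) :
    chart.{u} B S ∈ IsManifold.maximalAtlas (𝓡 n) ∞ (RealBott.{u} B) :=
  IsManifold.subset_maximalAtlas ⟨S, rfl⟩

/-- Points in different fibres are separated in the cube; points in one fibre lie in a common chart,
chart domains being invariant. -/
instance : T2Space (RealBott.{u} B) := by
  refine ⟨fun x y hxy => ?_⟩
  by_cases h : proj y = proj x
  · have hx := mem_chart_source (rfl : proj x = proj x)
    have hy := mem_chart_source h
    set f := chart B {i | proj x i ≠ 0}
    obtain ⟨U, V, hU, hV, hxU, hyV, hUV⟩ := t2_separation fun e => hxy (f.injOn hx hy e)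
    refine ⟨_, _, f.isOpen_inter_preimage hU, f.isOpen_inter_preimage hV, ⟨hx, hxU⟩, ⟨hy, hyV⟩, ?_⟩
    exact (hUV.preimage f).mono Set.inter_subset_right Set.inter_subset_right
  · exact separated_by_continuous continuous_proj (Ne.symm h)

instance : CompactSpace (RealBott.{u} B) := by
  have hK : IsCompact (WithLp.toLp 2 '' Set.univ.pi fun _ : Fin n => Set.Icc (-1 : ℝ) 1 :
      Set (EuclideanSpace ℝ (Fin n))) :=
    (isCompact_univ_pi fun _ => isCompact_Icc).image (PiLp.continuous_toLp 2 _)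
  have hU := isCompact_iUnion fun S : Set (Fin n) => hK.image (continuous_param.{u} (B := B) S)
  refine ⟨hU.of_isClosed_subset isClosed_univ fun x _ => ?_⟩
  obtain ⟨y, hy, hyx⟩ := mem_chart_source (rfl : proj x = proj x)
  refine Set.mem_iUnion.2 ⟨_, y, ⟨y.ofLp, fun i _ => ?_, rfl⟩, hyx⟩
  exact ⟨(abs_lt.1 (hy i)).1.le, (abs_lt.1 (hy i)).2.le⟩

theorem contMDiff_vadd (t : Z2 n) :
    ContMDiff (𝓡 n) (𝓡 n) ∞ (fun x : RealBott.{u} B => t +ᵥ x) := by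
  intro x
  have hx := mem_chart_source (rfl : proj x = proj x)
  set S := {i | proj x i ≠ 0}
  have h1 := contMDiffAt_of_mem_maximalAtlas (chart_mem_maximalAtlas S) hx
  have h2 : ContMDiffAt (𝓡 n) (𝓡 n) ∞ (stdAct (chartAut B S t)) (chart B S x) :=
    (contDiff_stdAct _).contMDiff.contMDiffAt
  have hmem : stdAct (chartAut B S t) (chart B S x) ∈ (chart.{u} B S).target :=
    stdAct_mem_box ((chart B S).map_source hx)
  have h3 := contMDiffAt_symm_of_mem_maximalAtlas (chart_mem_maximalAtlas S) hmem
  refine ((h3.comp _ h2).comp x h1).congr_of_eventuallyEq ?_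
  filter_upwards [(chart B S).open_source.mem_nhds hx] with y hy
  obtain ⟨hm, he⟩ := chart_equivariant S t y hy
  simp only [Function.comp_apply]
  rw [← he, (chart B S).left_inv hm]

theorem isLocallyStandard : IsLocallyStandard n (RealBott.{u} B) := fun _ =>
  ⟨chartAut B _, chart B _, chart_mem_maximalAtlas _, mem_chart_source rfl,
    fun t => chart_equivariant _ t⟩

theorem card_stabilizer (x : RealBott.{u} B) :
    Nat.card (AddAction.stabilizer (Z2 n) x) = 2 ^ (proj x).codim := by
  have hx := mem_chart_source (rfl : proj x = proj x)
  set S := {i | proj x i ≠ 0}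
  have h1 : Nat.card (AddAction.stabilizer (Z2 n) x) =
      Nat.card {w : Z2 n // ∀ i, w i = 0 ∨ chart B S x i = 0} :=
    Nat.card_congr ((chartAut B S).toEquiv.subtypeEquiv fun t =>
      mem_stabilizer_iff_of_chart (chart_equivariant S) hx)
  rw [h1, Z2.natCard_supported, Cube.codim_eq]
  -- A chart coordinate vanishes exactly where the coordinate upstairs is an integer, that is, where
  -- `fold` is 0 or 1.
  congr 2
  obtain ⟨y, hy, hyx⟩ := hx
  have hyx : param B S y = x := hyx
  rw [← hyx, chart_param hy]
  ext i
  simp only [Set.mem_ofPred_eq, param, proj_mk, PiLp.add_apply]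
  obtain ⟨v, hv⟩ : ∃ v : ℤ, vertex S i = v := by
    by_cases hi : i ∈ S
    · exact ⟨1, by simp [vertex, hi]⟩
    · exact ⟨0, by simp [vertex, hi]⟩
  rw [hv]
  constructor
  · intro h
    rw [h, add_zero]
    exact fold_intCast v
  · intro h
    obtain ⟨m, hm⟩ : ∃ m : ℤ, (v : ℝ) + y i = m := by
      rcases h with h | h
      · obtain ⟨m, hm⟩ := exists_of_fold_eq_zero h
        exact ⟨2 * m, by rw [hm]; push_cast; ring⟩
      · obtain ⟨m, hm⟩ := exists_of_fold_eq_one h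
        exact ⟨2 * m + 1, by rw [hm]; push_cast; ring⟩
    have hyi : y i = ((m - v : ℤ) : ℝ) := by push_cast; linarith
    have h3 : |m - v| < 1 := by
      rw [← Int.cast_lt (R := ℝ), Int.cast_abs, Int.cast_one, ← hyi]
      exact hy i
    rw [hyi, Int.abs_lt_one_iff.1 h3, Int.cast_zero]

variable (B) in
/-- The real Bott manifold as a small cover over the cube. -/
noncomputable def smallCover : SmallCover.{u} n where
  carrier := RealBott.{u} B
  smooth_action := contMDiff_vadd
  locallyStandard := isLocallyStandard
  proj := proj
  isQuotientMap_proj :=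
    continuous_proj.isClosedMap.isQuotientMap continuous_proj proj_surjective
  proj_eq_iff := proj_eq_iff
  card_stabilizer := card_stabilizer

/-! ### The characteristic matrix of a real Bott manifold -/

variable (B) in
theorem apply_self (j : Fin n) : B j j = 1 := by
  have h := hB.out {j}
  have hj : ∀ i : ({j} : Finset (Fin n)), (i : Fin n) = j := fun i => Finset.mem_singleton.1 i.2
  have : Unique ({j} : Finset (Fin n)) :=
    ⟨⟨⟨j, Finset.mem_singleton_self j⟩⟩, fun i => Subtype.ext (hj i)⟩
  rwa [Matrix.det_unique, Matrix.submatrix_apply, hj] at h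

theorem col_vadd_mk (F : Fin n ⊕ Fin n) {x : EuclideanSpace ℝ (Fin n)}
    (hx : proj (mk.{u} B x) ∈ Cube.facet F) :
    (Matrix.fromCols 1 B).col F +ᵥ mk.{u} B x = mk B x := by
  rw [vadd_mk, eq_comm, mk_eq_mk_iff]
  rcases F with j | j
  · obtain ⟨m, hm⟩ := exists_of_fold_eq_zero (show fold (x j) = 0 from hx)
    -- Translation by -4m takes 2m to -2m, and an even `k` changes no signs.
    refine ⟨Pi.single j (-(2 * m)), ?_⟩
    have hs : deckSign B (Pi.single j (-(2 * m))) = 0 := by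
      rw [← deckSign_zero (B := B)]
      refine deckSign_congr fun i => ?_
      by_cases hi : i = j
      · subst hi
        simp [CharTwo.two_eq_zero]
      · simp [hi]
    ext i
    rw [deckAct_apply, hs, stdAct_apply_eq_signZ2]
    by_cases hi : i = j
    · subst hi
      simp [signZ2_zero, signZ2_one, hm]
      ring
    · simp [hi, signZ2_zero]
  · obtain ⟨m, hm⟩ := exists_of_fold_eq_one (show fold (x j) = 1 from hx)
    -- Here `k` is odd, so the signs are column j of 1 + B. Since `B j j = 1`, coordinate j keeps
    -- its sign and is moved from 2m + 1 to its negative by the translation alone.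
    refine ⟨Pi.single j (-(2 * m + 1)), ?_⟩
    have hs : deckSign B (Pi.single j (-(2 * m + 1))) = (1 + B).col j := by
      rw [← Matrix.mulVec_single_one, deckSign]
      congr 1
      ext i
      by_cases hi : i = j
      · subst hi
        simp [CharTwo.two_eq_zero]
      · simp [hi]
    ext i
    rw [deckAct_apply, hs, stdAct_apply_eq_signZ2]
    by_cases hi : i = j
    · subst hi
      have h11 : (1 + 1 : ZMod 2) = 0 := rfl
      simp [apply_self B, signZ2_zero, signZ2_one, hm, h11]
      ring
    · simp [hi]

theorem isCharMatrix_smallCover :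
    (smallCover.{u} B).IsCharMatrix (Matrix.fromCols 1 B) := by
  intro F x hx
  obtain ⟨x, rfl⟩ := mk_surjective x
  have hne : (Matrix.fromCols 1 B).col F ≠ 0 := by
    intro h
    have := congrFun h (Cube.facetIndex F)
    rcases F with j | j
    · simp [Cube.facetIndex] at this
    · simp [Cube.facetIndex, apply_self B] at this
  symm
  refine AddSubgroup.eq_of_le_of_card_ge ?_ ?_
  · rw [AddSubgroup.zmultiples_le]
    exact col_vadd_mk F hx.1
  · refine ((smallCover B).card_stabilizer _).le.trans ?_
    rw [Cube.codim_eq_one_of_mem hx, pow_one]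
    exact (Z2.natCard_zmultiples hne).ge

end RealBott

/-! ### The bijection with M(n) and the count -/

namespace SmallCover

variable {n : ℕ}

/-- The reduced characteristic matrix `A⁻¹B` of a small cover. -/
noncomputable def reducedMatrix (X : SmallCover.{u} n) : principalMinorsOne n :=
  ⟨_, X.exists_isCharMatrix.choose_spec.mem_principalMinorsOne⟩

theorem reducedMatrix_eq_iff {X Y : SmallCover.{u} n} :
    X.reducedMatrix = Y.reducedMatrix ↔ X.DJEquiv Y := by
  rw [Subtype.ext_iff]
  exact ⟨djEquiv_of_inv_mul_eq X.exists_isCharMatrix.choose_spec Y.exists_isCharMatrix.choose_spec,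
    fun h => inv_mul_eq_of_djEquiv h X.exists_isCharMatrix.choose_spec
      Y.exists_isCharMatrix.choose_spec⟩

theorem reducedMatrix_surjective :
    Function.Surjective (reducedMatrix : SmallCover.{u} n → principalMinorsOne n) := by
  rintro ⟨B, hB⟩
  have : Fact (B ∈ principalMinorsOne n) := ⟨hB⟩
  refine ⟨RealBott.smallCover B, Subtype.ext ?_⟩
  have h := (RealBott.smallCover.{u} B).exists_isCharMatrix.choose_spec.unique
    RealBott.isCharMatrix_smallCover
  simp only [reducedMatrix]
  rw [h, Matrix.toCols₁_fromCols, Matrix.toCols₂_fromCols, inv_one, one_mul]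

/-- The D-J classes of small covers over the cube correspond to the matrices with all principal
minors equal to `1`. -/
noncomputable def djClassEquiv (n : ℕ) : DJClass.{u} n ≃ principalMinorsOne n :=
  Equiv.ofBijective (Quotient.lift reducedMatrix fun _ _ h => reducedMatrix_eq_iff.2 h)
    ⟨by
      rintro ⟨X⟩ ⟨Y⟩ h
      exact Quotient.sound (reducedMatrix_eq_iff.1 h),
    fun B => by
      obtain ⟨X, hX⟩ := reducedMatrix_surjective B
      exact ⟨X.djClass, hX⟩⟩

end SmallCover

theorem mainTheorem1 (n : ℕ) :
    Nat.card (SmallCover.DJClass.{u} n) =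
        Nat.card {G : Digraph (Fin n) // G.IsAcyclicDigraph} ∧
      (∃ Φ : SmallCover.DJClass.{u} n ≃ principalMinorsOne n,
        ∀ X : SmallCover.{u} n, ∃ Λ : Matrix (Fin n) (Fin n ⊕ Fin n) (ZMod 2),
          X.IsCharMatrix Λ ∧ IsUnit Λ.toCols₁.det ∧
            (Φ X.djClass : Matrix (Fin n) (Fin n) (ZMod 2)) = Λ.toCols₁⁻¹ * Λ.toCols₂) ∧
      Set.BijOn (fun G : Digraph (Fin n) => 1 + G.adjMatrixZ2)
        {G | G.IsAcyclicDigraph} (principalMinorsOne n) := by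
  refine ⟨?_, ⟨SmallCover.djClassEquiv n, fun X => ?_⟩, Digraph.bijOn_one_add_adjMatrixZ2 n⟩
  · exact Nat.card_congr ((SmallCover.djClassEquiv n).trans
      ((Digraph.bijOn_one_add_adjMatrixZ2 n).equiv _).symm)
  · have hΛ := X.exists_isCharMatrix.choose_spec
    exact ⟨_, hΛ, hΛ.isUnit_toCols₁, rfl⟩
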